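/- Let $0<a\le\infty$, let $f$ be a complex function that is analytic at every real point $x$ with $0\le x\le a$ (at every $x\ge 0$ if $a=\infty$), and let $\rho_0\in(0,\infty]$ be the distance from the origin to the nearest singularity of $f$ ($\rho_0=\infty$ if $f$ is entire). Let $0<\nu<1$ and $0<\omega<\min(a,\rho_0)$. If $a=\infty$, assume also that the principal value $\operatorname{PV}\!\int_0^{\infty}\frac{\omega f(x)}{x^\nu(\omega^2-x^2)}\,dx=\lim_{b\to\infty}\operatorname{PV}\!\int_0^b\frac{\omega f(x)}{x^\nu(\omega^2-x^2)}\,dx$ exists or that $f(x)x^{-2-\nu}$ is integrable at infinity. Here PV denotes the Cauchy principal value at $x=\omega$. For finite $b$, the finite part $\operatorname{f.p.}\!\int_0^b h(x)\,dx$ is $\lim_{\varepsilon\to0^+}C_\varepsilon$, where $\int_\varepsilon^b h(x)\,dx=C_\varepsilon+D_\varepsilon$, the limit exists, and $D_\varepsilon$ is a finite linear combination of diverging powers $\varepsilon^{-p}$, $p>0$, and of $\ln\varepsilon$. Integrals, principal values and finite parts with upper limit $\infty$ are the limits as $b\to\infty$ of those with upper limit $b$. Then, with all integrals, principal values and finite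 parts below existing and all series converging, the following hold. (1) If $f(0)\ne0$, then $$\operatorname{PV}\!\int_0^a\frac{\omega f(x)}{x^\nu(\omega^2-x^2)}\,dx=-\sum_{k=0}^\infty\omega^{2k+1}\operatorname{f.p.}\!\int_0^a\frac{f(x)}{x^{2k+\nu+2}}\,dx+\frac{\pi}{2\omega^\nu}\left(\frac{f(-\omega)}{\sin(\pi\nu)}-f(\omega)\cot(\pi\nu)\right).$$ (2) If $f(0)\neq0$ and $f$ is even, i.e. $f(-x)=f(x)$ for all real $x$ with $|x|<\rho_0$, then $$\operatorname{PV}\!\int_0^a\frac{\omega f(x)}{x^\nu(\omega^2-x^2)}\,dx=-\sum_{k=0}^\infty\omega^{2k+1}\operatorname{f.p.}\!\int_0^a\frac{f(x)}{x^{2k+\nu+2}}\,dx+\frac{\pi}{2}\,\frac{f(\omega)}{\omega^\nu}\tan\frac{\pi\nu}{2}.$$ (3) If $f(z)=z^m g(z)$ wherever $f$ is analytic, where $m$ is a positive integer and $g$ is analytic at $0$ with $g(0)\ne0$, then $$\operatorname{PV}\!\int_0^a\frac{\omega f(x)}{x^\nu(\omega^2-x^2)}\,dx=-\sum_{k=0}^{\lfloor(m-2)/2\rfloor}\omega^{2k+1}\int_0^a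 x^{m-2k-\nu-2}g(x)\,dx-\sum_{k=0}^\infty\omega^{2k+2\lfloor m/2\rfloor+1}\operatorname{f.p.}\!\int_0^a\frac{x^m g(x)}{x^{2k+2\lfloor m/2\rfloor+\nu+2}}\,dx$$ $$\qquad-\frac{\pi\omega^{m-\nu}}{2}\left[g(\omega)\cot(\pi\nu)-\frac{(-1)^m g(-\omega)}{\sin(\pi\nu)}\right],$$ where the first sum is empty if $m=1$. -/

import Mathlib

open Filter Topology MeasureTheory

/-- `f` is complex analytic in the real interval with endpoints `0` and `a`, where `0 < a ≤ ∞`: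
it is analytic at every real point `x` with `0 ≤ x ≤ a` (for `a = ∞`: at every `x ≥ 0`).
The function on the interval is `x ↦ f x`, and `f` itself is its complex extension. -/
def ComplexAnalyticUpTo (f : ℂ → ℂ) (a : EReal) : Prop :=
  ∀ x : ℝ, 0 ≤ x → (x : EReal) ≤ a → AnalyticAt ℂ f (x : ℂ)

/-- `ρ₀`: the distance from the origin to the nearest singularity (point of non-analyticity)
of `f`. It is `∞` when `f` is entire. -/
noncomputable def singularityDist (f : ℂ → ℂ) : ENNReal :=
  Metric.infEDist 0 {z : ℂ | ¬ AnalyticAt ℂ f z}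

/-- `I` is the (convergent) integral of `h` over `[0, b]`, for a real `b`. -/
def HasIntegralTo (h : ℝ → ℂ) (b : ℝ) (I : ℂ) : Prop :=
  IntervalIntegrable h volume 0 b ∧ ∫ x in (0 : ℝ)..b, h x = I

/-- `I` is the Cauchy principal value of the integral of `h` over `[0, b]`, for a real `b`,
with respect to the singular point `c`, where `0 < c < b`. -/
def HasPVTo (h : ℝ → ℂ) (c b : ℝ) (I : ℂ) : Prop :=
  (∀ᶠ ε : ℝ in 𝓝[>] 0,
    IntervalIntegrable h volume 0 (c - ε) ∧ IntervalIntegrable h volume (c + ε) b) ∧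
  Tendsto (fun ε : ℝ => (∫ x in (0 : ℝ)..(c - ε), h x) + ∫ x in (c + ε)..b, h x)
    (𝓝[>] 0) (𝓝 I)

/-- `I` is the finite part of the integral of `h` over `[0, b]`, for a real `b > 0`: for
`0 < ε < b` the integral over `[ε, b]` splits as `C ε + D ε`, where `D ε` is a finite linear
combination of diverging powers `ε ^ (-p)`, `p > 0`, and of `log ε`, and `C ε → I` as `ε → 0+`. -/
def HasFinitePartTo (h : ℝ → ℂ) (b : ℝ) (I : ℂ) : Prop :=
  ∃ C D : ℝ → ℂ,
    (∀ ε : ℝ, 0 < ε → ε < b →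
      IntervalIntegrable h volume ε b ∧ ∫ x in ε..b, h x = C ε + D ε) ∧
    (∃ (s : Finset ℝ) (u : ℝ → ℂ) (v : ℂ), (∀ p ∈ s, 0 < p) ∧
      ∀ ε : ℝ, 0 < ε → ε < b →
        D ε = (∑ p ∈ s, u p * ((ε ^ (-p) : ℝ) : ℂ)) + v * ((Real.log ε : ℝ) : ℂ)) ∧
    Tendsto C (𝓝[>] 0) (𝓝 I)

/-- Extends a notion `Q b I` ("`I` is the value over `[0, b]`", for real `b`) to upper limits
`a ≤ ∞`. The value for `a = ∞` is the limit of the values over `[0, b]` as `b → ∞`. -/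
def HasValueTo (Q : ℝ → ℂ → Prop) (a : EReal) (I : ℂ) : Prop :=
  (∃ b : ℝ, a = (b : EReal) ∧ Q b I) ∨
  (a = ⊤ ∧ ∃ P : ℝ → ℂ, (∀ᶠ b : ℝ in atTop, Q b (P b)) ∧ Tendsto P atTop (𝓝 I))

/-- `I` is the integral of `h` from `0` to `a ≤ ∞` (improper at infinity if `a = ∞`). -/
def HasIntegralUpTo (h : ℝ → ℂ) (a : EReal) (I : ℂ) : Prop :=
  HasValueTo (HasIntegralTo h) a I

/-- `I` is the principal value, with respect to the singular point `c`, of the integral of `h`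
from `0` to `a ≤ ∞`. -/
def HasPVUpTo (h : ℝ → ℂ) (c : ℝ) (a : EReal) (I : ℂ) : Prop :=
  HasValueTo (HasPVTo h c) a I

/-- `I` is the finite part of the integral of `h` from `0` to `a ≤ ∞`. -/
def HasFinitePartUpTo (h : ℝ → ℂ) (a : EReal) (I : ℂ) : Prop :=
  HasValueTo (HasFinitePartTo h) a I

/-- The integrand `ω f(x) / (x ^ ν (ω² - x²))`. -/
noncomputable def parityKernel (f : ℂ → ℂ) (ν ω : ℝ) (x : ℝ) : ℂ :=
  (ω : ℂ) * f (x : ℂ) / ((x ^ ν * (ω ^ 2 - x ^ 2) : ℝ) : ℂ)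

/-! Formally, expanding `1/(ω² - x²)` in powers of `ω/x` and integrating termwise yields the series
of finite parts with a minus sign. The expansion fails for `x ≤ ω`, and the extra term in `f(±ω)` is
the correction.

For finite `a = b`, write `f(z) = A + B z + (z² - ω²) q(z)` with `A + B z` interpolating `f` at `±ω`
(`exists_eq_linear_add_sq_sub_sq_mul`). In the quotient part the kernel becomes `-ω x^(-ν) q`, with
no pole, while its series of finite parts telescopes to `ω ∫ x^(-ν) q`; no correction appears. What
remains is the formula for the powers `x^(-ν)` and `x^(1-ν)`, proved by hand in
`exists_hasPVTo_rpow`: the map `x ↦ 1/x` folds the part beyond the pole onto `(0, 1)`, and the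
Mittag-Leffler series of the cotangent evaluates the result as a tangent. Half-angle identities turn
the two tangents into `1/sin` and `cot`.

Convergence rests on the bound `C r^(-2k)` for the `k`-th finite part with some `r > ω`
(`exists_hasFinitePartTo_norm_le`). For `a = ∞`, integration by parts makes this bound uniform in
`b`, although the kernel may converge only conditionally, and dominated convergence lets `b → ∞`
under the sum (`exists_hasSum_hasPVUpTo_top`).

The even case is a half-angle identity. For a zero of order `m`, the first `⌊m/2⌋` finite parts are
ordinary integrals and are split off the series. -/

/-! ### Finite parts: uniqueness, linearity, powers -/

/-- A finite linear combination of diverging powers of `ε` and of `log ε`. -/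
noncomputable def divergentPart (s : Finset ℝ) (u : ℝ → ℂ) (v : ℂ) (ε : ℝ) : ℂ :=
  (∑ p ∈ s, u p * ((ε ^ (-p) : ℝ) : ℂ)) + v * ((Real.log ε : ℝ) : ℂ)

theorem divergentPart_add (s t : Finset ℝ) (u u' : ℝ → ℂ) (v v' : ℂ) :
    ∃ w : ℝ → ℂ, ∀ ε, divergentPart s u v ε + divergentPart t u' v' ε
      = divergentPart (s ∪ t) w (v + v') ε := by
  refine ⟨fun p => (if p ∈ s then u p else 0) + (if p ∈ t then u' p else 0), fun ε => ?_⟩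
  have h1 : ∑ p ∈ s ∪ t, (if p ∈ s then u p else 0) * ((ε ^ (-p) : ℝ) : ℂ)
      = ∑ p ∈ s, u p * ((ε ^ (-p) : ℝ) : ℂ) := by
    rw [← Finset.sum_subset (Finset.subset_union_left (s₁ := s) (s₂ := t))]
    · exact Finset.sum_congr rfl fun p hp => by simp [hp]
    · intro p _ hp; simp [hp]
  have h2 : ∑ p ∈ s ∪ t, (if p ∈ t then u' p else 0) * ((ε ^ (-p) : ℝ) : ℂ)
      = ∑ p ∈ t, u' p * ((ε ^ (-p) : ℝ) : ℂ) := by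
    rw [← Finset.sum_subset (Finset.subset_union_right (s₁ := s) (s₂ := t))]
    · exact Finset.sum_congr rfl fun p hp => by simp [hp]
    · intro p _ hp; simp [hp]
  simp only [divergentPart, add_mul, Finset.sum_add_distrib, h1, h2]
  ring

theorem divergentPart_const_mul (s : Finset ℝ) (u : ℝ → ℂ) (v c : ℂ) (ε : ℝ) :
    c * divergentPart s u v ε = divergentPart s (fun p => c * u p) (c * v) ε := by
  simp only [divergentPart, mul_add, Finset.mul_sum, mul_assoc]

theorem IntervalIntegrable.ofReal_comp {h : ℝ → ℝ} {a b : ℝ}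
    (hi : IntervalIntegrable h volume a b) :
    IntervalIntegrable (fun x => ((h x : ℝ) : ℂ)) volume a b :=
  ⟨hi.1.ofReal, hi.2.ofReal⟩

theorem tendsto_ofReal_rpow_nhdsGT_zero {p : ℝ} (hp : 0 < p) :
    Tendsto (fun ε : ℝ => ((ε ^ p : ℝ) : ℂ)) (𝓝[>] 0) (𝓝 0) := by
  have h : Tendsto (fun ε : ℝ => ε ^ p) (𝓝[>] 0) (𝓝 0) := by
    have := (Real.continuousAt_rpow_const 0 p (Or.inr hp.le)).tendsto
    rw [Real.zero_rpow hp.ne'] at this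
    exact this.mono_left nhdsWithin_le_nhds
  have h2 := (Complex.continuous_ofReal.tendsto (0 : ℝ)).comp h
  rwa [Complex.ofReal_zero] at h2

/-- This is why finite parts are unique. Multiplying by `ε ^ a`, with `a` the largest exponent,
sends every other term to `0` and leaves the coefficient `u a`, which must therefore vanish. Once
all powers are removed, a nonzero multiple of `log ε` would be unbounded. -/
theorem limit_eq_zero_of_tendsto_divergentPart (s : Finset ℝ) (u : ℝ → ℂ) (v L : ℂ)
    (hs : ∀ p ∈ s, 0 < p) (h : Tendsto (divergentPart s u v) (𝓝[>] 0) (𝓝 L)) : L = 0 := by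
  induction s using Finset.induction_on_max with
  | empty =>
    have hv : v = 0 := by
      by_contra hv
      have h1 : Tendsto (fun ε : ℝ => ‖divergentPart ∅ u v ε‖) (𝓝[>] 0) atTop := by
        have h2 : Tendsto (fun ε : ℝ => ‖v‖ * |Real.log ε|) (𝓝[>] 0) atTop :=
          (tendsto_abs_atBot_atTop.comp Real.tendsto_log_nhdsGT_zero).const_mul_atTop
            (norm_pos_iff.mpr hv)
        refine h2.congr fun ε => ?_
        simp only [divergentPart, Finset.sum_empty, zero_add, norm_mul, Complex.norm_real,
          Real.norm_eq_abs]
      exact not_tendsto_nhds_of_tendsto_atTop h1 _ h.norm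
    subst hv
    refine tendsto_nhds_unique h ?_
    refine tendsto_const_nhds.congr fun ε => ?_
    simp [divergentPart]
  | insert a s ha ih =>
    have ha0 : 0 < a := hs a (Finset.mem_insert_self _ _)
    have has : a ∉ s := fun h => lt_irrefl _ (ha a h)
    have h1 : Tendsto (fun ε : ℝ => ((ε ^ a : ℝ) : ℂ) * divergentPart (insert a s) u v ε)
        (𝓝[>] 0) (𝓝 0) := by
      simpa using (tendsto_ofReal_rpow_nhdsGT_zero ha0).mul h
    have h2 : Tendsto (fun ε : ℝ => u a + (∑ p ∈ s, u p * ((ε ^ (a - p) : ℝ) : ℂ)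
        + v * ((Real.log ε * ε ^ a : ℝ) : ℂ))) (𝓝[>] 0) (𝓝 (u a + (∑ p ∈ s, u p * 0 + v * 0))) := by
      refine tendsto_const_nhds.add (Tendsto.add (tendsto_finsetSum _ fun p hp => ?_) ?_)
      · exact (tendsto_ofReal_rpow_nhdsGT_zero (sub_pos.mpr (ha p hp))).const_mul _
      · have := (Complex.continuous_ofReal.tendsto (0 : ℝ)).comp
          (tendsto_log_mul_rpow_nhdsGT_zero ha0)
        rw [Complex.ofReal_zero] at this
        exact this.const_mul v
    have h3 : u a = 0 := by
      have := tendsto_nhds_unique (h2.congr' ?_) h1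
      · simpa using this
      · filter_upwards [self_mem_nhdsWithin] with ε hε
        have hε : 0 < ε := hε
        have e1 : ((ε ^ a : ℝ) : ℂ) * ((ε ^ (-a) : ℝ) : ℂ) = 1 := by
          rw [← Complex.ofReal_mul, ← Real.rpow_add hε]; simp
        have e2 : ∀ p ∈ s, u p * ((ε ^ (a - p) : ℝ) : ℂ)
            = ((ε ^ a : ℝ) : ℂ) * (u p * ((ε ^ (-p) : ℝ) : ℂ)) := fun p _ => by
          rw [sub_eq_add_neg, Real.rpow_add hε]; push_cast; ring
        rw [Finset.sum_congr rfl e2, ← Finset.mul_sum, divergentPart, Finset.sum_insert has]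
        push_cast
        linear_combination (-u a) * e1
    refine ih (fun p hp => hs p (Finset.mem_insert_of_mem hp)) (h.congr fun ε => ?_)
    simp [divergentPart, Finset.sum_insert has, h3]

/-- Eliminating `C` turns the finite part into an ordinary limit, on which the limit laws act
directly. -/
theorem hasFinitePartTo_iff {h : ℝ → ℂ} {b : ℝ} {I : ℂ} (hb : 0 < b) :
    HasFinitePartTo h b I ↔
      (∀ ε : ℝ, 0 < ε → ε < b → IntervalIntegrable h volume ε b) ∧
      ∃ (s : Finset ℝ) (u : ℝ → ℂ) (v : ℂ), (∀ p ∈ s, 0 < p) ∧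
        Tendsto (fun ε => (∫ x in ε..b, h x) - divergentPart s u v ε) (𝓝[>] 0) (𝓝 I) := by
  constructor
  · rintro ⟨C, D, h1, ⟨s, u, v, hs, hD⟩, hC⟩
    refine ⟨fun ε h0 hεb => (h1 ε h0 hεb).1, s, u, v, hs, hC.congr' ?_⟩
    filter_upwards [Ioo_mem_nhdsGT hb] with ε hε
    rw [(h1 ε hε.1 hε.2).2, hD ε hε.1 hε.2, divergentPart]
    ring
  · rintro ⟨h1, s, u, v, hs, hC⟩
    exact ⟨_, divergentPart s u v, fun ε h0 hεb => ⟨h1 ε h0 hεb, by ring⟩,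
      ⟨s, u, v, hs, fun ε _ _ => rfl⟩, hC⟩

theorem HasFinitePartTo.unique {h : ℝ → ℂ} {b : ℝ} {I J : ℂ} (hb : 0 < b)
    (hI : HasFinitePartTo h b I) (hJ : HasFinitePartTo h b J) : I = J := by
  obtain ⟨-, s, u, v, hs, hI⟩ := (hasFinitePartTo_iff hb).1 hI
  obtain ⟨-, t, u', v', ht, hJ⟩ := (hasFinitePartTo_iff hb).1 hJ
  obtain ⟨w, hw⟩ := divergentPart_add s t u (fun p => -1 * u' p) v (-1 * v')
  have h := limit_eq_zero_of_tendsto_divergentPart (s ∪ t) w (v + -1 * v') (J - I)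
    (fun p hp => (Finset.mem_union.1 hp).elim (hs p) (ht p))
    ((hJ.sub hI).congr fun ε => by
      rw [← hw, ← divergentPart_const_mul]; ring)
  exact (sub_eq_zero.1 h).symm

theorem HasFinitePartTo.add {h g : ℝ → ℂ} {b : ℝ} {I J : ℂ} (hb : 0 < b)
    (hI : HasFinitePartTo h b I) (hJ : HasFinitePartTo g b J) :
    HasFinitePartTo (fun x => h x + g x) b (I + J) := by
  obtain ⟨i1, s, u, v, hs, hI⟩ := (hasFinitePartTo_iff hb).1 hI
  obtain ⟨i2, t, u', v', ht, hJ⟩ := (hasFinitePartTo_iff hb).1 hJ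
  obtain ⟨w, hw⟩ := divergentPart_add s t u u' v v'
  refine (hasFinitePartTo_iff hb).2 ⟨fun ε h0 hε => (i1 ε h0 hε).add (i2 ε h0 hε), s ∪ t, w,
    v + v', fun p hp => (Finset.mem_union.1 hp).elim (hs p) (ht p), (hI.add hJ).congr' ?_⟩
  filter_upwards [Ioo_mem_nhdsGT hb] with ε hε
  rw [← hw, intervalIntegral.integral_add (i1 ε hε.1 hε.2) (i2 ε hε.1 hε.2)]
  ring

theorem HasFinitePartTo.const_mul {h : ℝ → ℂ} {b : ℝ} {I : ℂ} (hb : 0 < b) (c : ℂ)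
    (hI : HasFinitePartTo h b I) : HasFinitePartTo (fun x => c * h x) b (c * I) := by
  obtain ⟨i1, s, u, v, hs, hI⟩ := (hasFinitePartTo_iff hb).1 hI
  refine (hasFinitePartTo_iff hb).2 ⟨fun ε h0 hε => (i1 ε h0 hε).const_mul c, s,
    fun p => c * u p, c * v, hs, (hI.const_mul c).congr fun ε => ?_⟩
  rw [← divergentPart_const_mul, intervalIntegral.integral_const_mul]
  ring

theorem HasFinitePartTo.congr {h g : ℝ → ℂ} {b : ℝ} {I : ℂ} (hb : 0 < b)
    (hI : HasFinitePartTo h b I) (hg : ∀ x, 0 < x → x ≤ b → h x = g x) :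
    HasFinitePartTo g b I := by
  obtain ⟨i1, s, u, v, hs, hI⟩ := (hasFinitePartTo_iff hb).1 hI
  refine (hasFinitePartTo_iff hb).2 ⟨fun ε h0 hε => (i1 ε h0 hε).congr fun x hx => ?_, s, u, v, hs,
    hI.congr' ?_⟩
  · rw [Set.uIoc_of_le hε.le] at hx
    exact hg x (h0.trans hx.1) hx.2
  · filter_upwards [Ioo_mem_nhdsGT hb] with ε hε
    congr 1
    refine intervalIntegral.integral_congr fun x hx => ?_
    rw [Set.uIcc_of_le hε.2.le] at hx
    exact hg x (hε.1.trans_le hx.1) hx.2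

theorem tendsto_integral_left_nhdsGT_zero {h : ℝ → ℂ} {b : ℝ} (hb : 0 < b)
    (hi : IntervalIntegrable h volume 0 b) :
    Tendsto (fun ε => ∫ x in ε..b, h x) (𝓝[>] 0) (𝓝 (∫ x in (0 : ℝ)..b, h x)) := by
  have hc := intervalIntegral.continuousOn_primitive_interval_left (a := 0) (b := b) (f := h)
    (μ := volume) ((intervalIntegrable_iff' (by simp)).1 hi)
  rw [Set.uIcc_of_le hb.le] at hc
  have h1 := (hc 0 (Set.left_mem_Icc.2 hb.le)).tendsto
  refine h1.mono_left ?_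
  rw [← nhdsWithin_Ioo_eq_nhdsGT hb]
  exact nhdsWithin_mono _ Set.Ioo_subset_Icc_self

theorem hasFinitePartTo_of_intervalIntegrable {h : ℝ → ℂ} {b : ℝ} (hb : 0 < b)
    (hi : IntervalIntegrable h volume 0 b) : HasFinitePartTo h b (∫ x in (0 : ℝ)..b, h x) := by
  refine (hasFinitePartTo_iff hb).2 ⟨fun ε h0 hε => hi.mono_set ?_, ∅, 0, 0, by simp, ?_⟩
  · rw [Set.uIcc_of_le hε.le, Set.uIcc_of_le hb.le]
    exact Set.Icc_subset_Icc_left h0.le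
  · simpa [divergentPart] using tendsto_integral_left_nhdsGT_zero hb hi

theorem hasFinitePartTo_rpow {p b : ℝ} (hb : 0 < b) (hp : p ≠ -1) :
    HasFinitePartTo (fun x => ((x ^ p : ℝ) : ℂ)) b ((b ^ (p + 1) / (p + 1) : ℝ) : ℂ) := by
  rcases lt_or_gt_of_ne hp with hp | hp
  · have hI : ∀ ε : ℝ, 0 < ε → ε < b → (0 : ℝ) ∉ Set.uIcc ε b := fun ε h0 hε h => by
      rw [Set.uIcc_of_le hε.le] at h
      exact absurd h.1 (not_le.2 h0)
    refine (hasFinitePartTo_iff hb).2 ⟨fun ε h0 hε => ?_, {-(p + 1)},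
      fun _ => ((-(1 / (p + 1)) : ℝ) : ℂ), 0, ?_, ?_⟩
    · exact (intervalIntegral.intervalIntegrable_rpow (Or.inr (hI ε h0 hε))).ofReal_comp
    · simp only [Finset.mem_singleton, forall_eq]; linarith
    · refine tendsto_const_nhds.congr' ?_
      filter_upwards [Ioo_mem_nhdsGT hb] with ε hε
      rw [intervalIntegral.integral_ofReal,
        integral_rpow (Or.inr ⟨hp.ne, hI ε hε.1 hε.2⟩)]
      simp only [divergentPart, Finset.sum_singleton, neg_neg, zero_mul, add_zero]
      norm_cast
      ring
  · have h1 := hasFinitePartTo_of_intervalIntegrable hb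
      (intervalIntegral.intervalIntegrable_rpow' (a := 0) (b := b) hp).ofReal_comp
    rwa [intervalIntegral.integral_ofReal, integral_rpow (Or.inl hp),
      Real.zero_rpow (by linarith), sub_zero] at h1

/-- The divergent part sees only the lower endpoint, so moving the upper one adds an ordinary
integral. -/
theorem HasFinitePartTo.extend {h : ℝ → ℂ} {r b : ℝ} {I : ℂ} (hr : 0 < r) (hrb : r ≤ b)
    (hI : HasFinitePartTo h r I) (hi : IntervalIntegrable h volume r b) :
    HasFinitePartTo h b (I + ∫ x in r..b, h x) := by
  obtain ⟨i1, s, u, v, hs, hI⟩ := (hasFinitePartTo_iff hr).1 hI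
  have hb : 0 < b := hr.trans_le hrb
  refine (hasFinitePartTo_iff hb).2 ⟨fun ε h0 hε => ?_, s, u, v, hs, ?_⟩
  · rcases lt_or_ge ε r with h | h
    · exact (i1 ε h0 h).trans hi
    · refine hi.mono_set ?_
      rw [Set.uIcc_of_le hε.le, Set.uIcc_of_le hrb]
      exact Set.Icc_subset_Icc_left h
  · refine (hI.add_const _).congr' ?_
    filter_upwards [Ioo_mem_nhdsGT hr] with ε hε
    rw [← intervalIntegral.integral_add_adjacent_intervals (i1 ε hε.1 hε.2) hi]
    ring

theorem hasFinitePartTo_sum {ι : Type*} (s : Finset ι) {h : ι → ℝ → ℂ} {b : ℝ} {I : ι → ℂ}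
    (hb : 0 < b) (hI : ∀ i ∈ s, HasFinitePartTo (h i) b (I i)) :
    HasFinitePartTo (fun x => ∑ i ∈ s, h i x) b (∑ i ∈ s, I i) := by
  classical
  induction s using Finset.induction_on with
  | empty =>
    simpa using hasFinitePartTo_of_intervalIntegrable (h := fun _ => 0) hb (by simp)
  | insert a s ha ih =>
    simp only [Finset.sum_insert ha]
    exact (hI a (Finset.mem_insert_self _ _)).add hb
      (ih fun i hi => hI i (Finset.mem_insert_of_mem hi))

/-! ### Principal values: uniqueness and linearity -/

theorem HasPVTo.unique {h : ℝ → ℂ} {c b : ℝ} {I J : ℂ}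
    (hI : HasPVTo h c b I) (hJ : HasPVTo h c b J) : I = J :=
  tendsto_nhds_unique hI.2 hJ.2

theorem HasPVTo.add {h g : ℝ → ℂ} {c b : ℝ} {I J : ℂ}
    (hI : HasPVTo h c b I) (hJ : HasPVTo g c b J) :
    HasPVTo (fun x => h x + g x) c b (I + J) := by
  refine ⟨?_, (hI.2.add hJ.2).congr' ?_⟩
  · filter_upwards [hI.1, hJ.1] with ε h1 h2
    exact ⟨h1.1.add h2.1, h1.2.add h2.2⟩
  · filter_upwards [hI.1, hJ.1] with ε h1 h2
    rw [intervalIntegral.integral_add h1.1 h2.1, intervalIntegral.integral_add h1.2 h2.2]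
    ring

theorem HasPVTo.const_mul {h : ℝ → ℂ} {c b : ℝ} {I : ℂ} (k : ℂ)
    (hI : HasPVTo h c b I) : HasPVTo (fun x => k * h x) c b (k * I) := by
  refine ⟨?_, (hI.2.const_mul k).congr fun ε => ?_⟩
  · filter_upwards [hI.1] with ε h1
    exact ⟨h1.1.const_mul k, h1.2.const_mul k⟩
  · rw [intervalIntegral.integral_const_mul, intervalIntegral.integral_const_mul]
    ring

theorem eventually_lt_sub_add_lt {c b : ℝ} (hc : 0 < c) (hb : c < b) :
    ∀ᶠ ε : ℝ in 𝓝[>] 0, 0 < ε ∧ 0 < c - ε ∧ c + ε < b := by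
  filter_upwards [Ioo_mem_nhdsGT hc, Ioo_mem_nhdsGT (sub_pos.2 hb)] with ε h1 h2
  exact ⟨h1.1, by linarith [h1.2], by linarith [h2.2]⟩

theorem HasPVTo.congr {h g : ℝ → ℂ} {c b : ℝ} {I : ℂ} (hc : 0 < c) (hb : c < b)
    (hI : HasPVTo h c b I) (hg : ∀ x, 0 < x → x ≤ b → x ≠ c → h x = g x) : HasPVTo g c b I := by
  have key : ∀ ε, 0 < ε ∧ 0 < c - ε ∧ c + ε < b →
      (∀ x ∈ Set.uIoc 0 (c - ε), h x = g x) ∧ (∀ x ∈ Set.uIoc (c + ε) b, h x = g x) := by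
    rintro ε ⟨h0, h1, h2⟩
    rw [Set.uIoc_of_le h1.le, Set.uIoc_of_le h2.le]
    exact ⟨fun x hx => hg x hx.1 (by linarith [hx.2]) (by linarith [hx.2] : x < c).ne,
      fun x hx => hg x (by linarith [hx.1]) hx.2 (by linarith [hx.1] : c < x).ne'⟩
  refine ⟨?_, hI.2.congr' ?_⟩
  · filter_upwards [hI.1, eventually_lt_sub_add_lt hc hb] with ε h1 h2
    exact ⟨h1.1.congr fun x hx => (key ε h2).1 x hx, h1.2.congr fun x hx => (key ε h2).2 x hx⟩
  · filter_upwards [eventually_lt_sub_add_lt hc hb] with ε h2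
    rw [intervalIntegral.integral_congr_ae (Eventually.of_forall (key ε h2).1),
      intervalIntegral.integral_congr_ae (Eventually.of_forall (key ε h2).2)]

theorem hasPVTo_of_intervalIntegrable {h : ℝ → ℂ} {c b : ℝ} (hc : 0 < c) (hb : c < b)
    (hi : IntervalIntegrable h volume 0 b) : HasPVTo h c b (∫ x in (0 : ℝ)..b, h x) := by
  have hb0 : 0 < b := hc.trans hb
  have sub : ∀ y z, 0 ≤ y → y ≤ z → z ≤ b → IntervalIntegrable h volume y z :=
    fun y z h0 h1 h2 => hi.mono_set (by
      rw [Set.uIcc_of_le h1, Set.uIcc_of_le hb0.le]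
      exact Set.Icc_subset_Icc h0 h2)
  refine ⟨?_, ?_⟩
  · filter_upwards [eventually_lt_sub_add_lt hc hb] with ε h2
    exact ⟨sub _ _ le_rfl h2.2.1.le (by linarith), sub _ _ (by linarith) h2.2.2.le le_rfl⟩
  · have hint := (intervalIntegrable_iff' (by simp)).1 hi
    have hcl := intervalIntegral.continuousOn_primitive_interval_left (a := 0) (b := b) (f := h)
      (μ := volume) hint
    have hcr := intervalIntegral.continuousOn_primitive_interval (a := 0) (b := b) (f := h)
      (μ := volume) hint
    rw [Set.uIcc_of_le hb0.le] at hcl hcr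
    have hmem : Set.Icc 0 b ∈ 𝓝 c := Icc_mem_nhds hc hb
    have hl : Tendsto (fun ε : ℝ => c - ε) (𝓝[>] 0) (𝓝 c) := by
      have : Tendsto (fun ε : ℝ => c - ε) (𝓝 0) (𝓝 (c - 0)) := tendsto_const_nhds.sub tendsto_id
      rw [sub_zero] at this
      exact this.mono_left nhdsWithin_le_nhds
    have hr : Tendsto (fun ε : ℝ => c + ε) (𝓝[>] 0) (𝓝 c) := by
      have : Tendsto (fun ε : ℝ => c + ε) (𝓝 0) (𝓝 (c + 0)) := tendsto_const_nhds.add tendsto_id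
      rw [add_zero] at this
      exact this.mono_left nhdsWithin_le_nhds
    have := (((hcr.continuousAt hmem).tendsto.comp hl).add
      ((hcl.continuousAt hmem).tendsto.comp hr))
    rwa [intervalIntegral.integral_add_adjacent_intervals (sub _ _ le_rfl hc.le hb.le)
      (sub _ _ hc.le hb.le le_rfl)] at this

theorem HasPVTo.eq_add_integral {h : ℝ → ℂ} {c r b : ℝ} {I J : ℂ}
    (hI : HasPVTo h c r I) (hJ : HasPVTo h c b J) (hi : IntervalIntegrable h volume r b) :
    J = I + ∫ x in r..b, h x := by
  refine tendsto_nhds_unique hJ.2 ((hI.2.add_const _).congr' ?_)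
  filter_upwards [hI.1] with ε h1
  rw [← intervalIntegral.integral_add_adjacent_intervals h1.2 hi]
  ring

/-! ### Geometric bound for the finite parts near the origin -/

/-- Taylor's polynomial of degree `2k+1` is removed. Its monomials have explicit finite parts, with
exponents at most `-ν` after integration, hence no logarithm and no small denominator. The remainder
is `O(x^(2k+2))`, so its quotient is `O(x^(-ν))`, which is integrable. -/
theorem exists_hasFinitePartTo_norm_le {f : ℂ → ℂ} {ν r ρ : ℝ} (hν0 : 0 < ν) (hν1 : ν < 1)
    (hr : 0 < r) (hrρ : r < ρ) (hf : ∀ z : ℂ, ‖z‖ < ρ → AnalyticAt ℂ f z) :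
    ∃ (C : ℝ) (F : ℕ → ℂ), ∀ k : ℕ,
      HasFinitePartTo (fun x : ℝ => f (x : ℂ) / ((x ^ (2 * (k : ℝ) + ν + 2) : ℝ) : ℂ)) r (F k) ∧
      ‖F k‖ ≤ C * (r⁻¹ ^ 2) ^ k := by
  -- `r < r1 < r2 < ρ`: Cauchy's series lives on radius `r2`, and its geometric error estimate holds
  -- on the smaller disc of radius `r1`.
  obtain ⟨r2, hr2, hr2ρ⟩ := exists_between hrρ
  obtain ⟨r1, hr1, hr12⟩ := exists_between hr2
  have hr1p : 0 < r1 := hr.trans hr1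
  have hr2p : 0 < r2 := hr1p.trans hr12
  lift r2 to NNReal using hr2p.le
  lift r1 to NNReal using hr1p.le
  lift r to NNReal using hr.le
  have hdiff : DifferentiableOn ℂ f (Metric.closedBall 0 r2) := fun z hz =>
    (hf z (by rw [mem_closedBall_zero_iff] at hz; linarith)).differentiableAt.differentiableWithinAt
  have hps := hdiff.hasFPowerSeriesOnBall (by exact_mod_cast hr2p)
  set p := cauchyPowerSeries f 0 r2
  obtain ⟨a, ⟨ha0, ha1⟩, C, hC0, hC⟩ := hps.uniform_geometric_approx' (r' := r1)
    (by exact_mod_cast hr12)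
  have hsum : Summable fun n => ‖p n‖ * (r : ℝ) ^ n := p.summable_norm_mul_pow
    (lt_of_lt_of_le (by exact_mod_cast hr1.trans hr12) hps.r_le)
  have happ : ∀ (x : ℝ), 0 < x → x ≤ r → ∀ n,
      ‖f x - ∑ i ∈ Finset.range n, (x : ℂ) ^ i * p.coeff i‖ ≤ C * (x / r) ^ n := by
    intro x hx hxr n
    have h1 := hC (x : ℂ) (by
      rw [mem_ball_zero_iff, Complex.norm_real, Real.norm_of_nonneg hx.le]; linarith) n
    rw [zero_add, FormalMultilinearSeries.partialSum] at h1
    simp only [FormalMultilinearSeries.apply_eq_pow_smul_coeff, smul_eq_mul, Complex.norm_real,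
      Real.norm_of_nonneg hx.le] at h1
    refine h1.trans ?_
    gcongr
    calc a * (x / r1) ≤ 1 * (x / r1) := by gcongr
      _ ≤ x / r := by rw [one_mul]; gcongr
  set M := ∑' n, ‖p n‖ * (r : ℝ) ^ n
  set E : ℕ → ℕ → ℝ := fun k i => (i : ℝ) - (2 * (k : ℝ) + ν + 2) with hE
  set T : ℕ → ℝ → ℂ := fun k x => (f x - ∑ i ∈ Finset.range (2 * k + 2), (x : ℂ) ^ i * p.coeff i)
    / ((x ^ (2 * (k : ℝ) + ν + 2) : ℝ) : ℂ) with hT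
  have hTb : ∀ (k : ℕ) (x : ℝ), 0 < x → x ≤ r → ‖T k x‖ ≤ C * ((r : ℝ)⁻¹) ^ (2 * k + 2) * x ^ (-ν) := by
    intro k x hx hxr
    rw [hT]
    simp only [norm_div, Complex.norm_real, Real.norm_of_nonneg (Real.rpow_nonneg hx.le _)]
    rw [div_le_iff₀ (by positivity)]
    refine (happ x hx hxr _).trans_eq ?_
    rw [mul_assoc, ← Real.rpow_add hx, div_eq_mul_inv, mul_pow,
      ← Real.rpow_natCast x]
    push_cast
    ring_nf
  have hTi : ∀ k, IntervalIntegrable (T k) volume 0 r := by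
    intro k
    refine IntervalIntegrable.mono_fun'
      ((intervalIntegral.intervalIntegrable_rpow' (r := -ν) (by linarith)).const_mul
        (C * ((r : ℝ)⁻¹) ^ (2 * k + 2))) ?_ ?_
    · rw [Set.uIoc_of_le hr.le]
      refine ContinuousOn.aestronglyMeasurable (fun x hx => ?_) measurableSet_Ioc
      refine ContinuousAt.continuousWithinAt (ContinuousAt.div (ContinuousAt.sub ?_ ?_) ?_ ?_)
      · exact ContinuousAt.comp (f := fun x : ℝ => (x : ℂ)) (g := f)
          (hf x (by rw [Complex.norm_real, Real.norm_of_nonneg hx.1.le]; linarith [hx.2])).continuousAt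
          Complex.continuous_ofReal.continuousAt
      · fun_prop
      · exact Complex.continuous_ofReal.continuousAt.comp
          (Real.continuousAt_rpow_const _ _ (Or.inl hx.1.ne'))
      · exact_mod_cast (Real.rpow_pos_of_pos hx.1 _).ne'
    · rw [Set.uIoc_of_le hr.le]
      exact (ae_restrict_iff' measurableSet_Ioc).2
        (Eventually.of_forall fun x hx => hTb k x hx.1 hx.2)
  have hEne : ∀ k i, i < 2 * k + 2 → E k i + 1 ≤ -ν := fun k i hi => by
    have : (i : ℝ) + 1 ≤ 2 * k + 2 := by exact_mod_cast hi
    simp only [hE]; linarith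
  -- The first summand bounds the monomials, using `|E k i + 1| ≥ ν`; the second is the remainder
  -- bound integrated, `∫ x^(-ν) = r^(1-ν)/(1-ν)`.
  refine ⟨M * (r : ℝ) ^ (-ν - 1) / ν + C * (r : ℝ)⁻¹ ^ 2 * ((r : ℝ) ^ (1 - ν) / (1 - ν)),
    fun k => ∑ i ∈ Finset.range (2 * k + 2), p.coeff i * (((r : ℝ) ^ (E k i + 1) / (E k i + 1) : ℝ) : ℂ)
      + ∫ x in (0 : ℝ)..r, T k x, fun k => ⟨?_, ?_⟩⟩
  · refine ((hasFinitePartTo_sum _ hr fun i hi =>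
      (hasFinitePartTo_rpow hr ?_).const_mul hr (p.coeff i)).add hr
      (hasFinitePartTo_of_intervalIntegrable hr (hTi k))).congr hr fun x hx hxr => ?_
    · have := hEne k i (Finset.mem_range.1 hi)
      intro h
      rw [h] at this; linarith
    · have hx0 : ((x ^ (2 * (k : ℝ) + ν + 2) : ℝ) : ℂ) ≠ 0 := by
        exact_mod_cast (Real.rpow_pos_of_pos hx _).ne'
      simp only [hT, sub_div, Finset.sum_div]
      rw [add_sub_left_comm, ← Finset.sum_sub_distrib, Finset.sum_eq_zero, add_zero]
      intro i _
      rw [hE]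
      simp only
      rw [Real.rpow_sub hx, Real.rpow_natCast]
      push_cast
      field_simp
      ring
  · have h1 : ‖∑ i ∈ Finset.range (2 * k + 2),
        p.coeff i * (((r : ℝ) ^ (E k i + 1) / (E k i + 1) : ℝ) : ℂ)‖
        ≤ M * (r : ℝ) ^ (-ν - 1) / ν * ((r : ℝ)⁻¹ ^ 2) ^ k := by
      calc _ ≤ ∑ i ∈ Finset.range (2 * k + 2),
            (‖p i‖ * (r : ℝ) ^ i) * ((r : ℝ) ^ (-ν - 1) / ν * ((r : ℝ)⁻¹ ^ 2) ^ k) := by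
            refine (norm_sum_le _ _).trans (Finset.sum_le_sum fun i hi => ?_)
            have h2 := hEne k i (Finset.mem_range.1 hi)
            rw [norm_mul, Complex.norm_real, norm_div,
              Real.norm_of_nonneg (Real.rpow_nonneg hr.le _), p.norm_apply_eq_norm_coef, mul_assoc]
            refine mul_le_mul_of_nonneg_left ?_ (norm_nonneg _)
            have h3 : ν ≤ ‖E k i + 1‖ := by
              rw [Real.norm_eq_abs, abs_of_nonpos (by linarith)]; linarith
            have h4 : (r : ℝ) ^ (E k i + 1) = (r : ℝ) ^ i * (r : ℝ) ^ (-ν - 1) * ((r : ℝ)⁻¹ ^ 2) ^ k := by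
              rw [← pow_mul, inv_pow, ← Real.rpow_natCast _ i, ← Real.rpow_natCast _ (2 * k),
                ← Real.rpow_neg hr.le, ← Real.rpow_add hr, ← Real.rpow_add hr]
              congr 1
              simp only [hE]; push_cast; ring
            rw [h4]
            calc _ ≤ (r : ℝ) ^ i * (r : ℝ) ^ (-ν - 1) * ((r : ℝ)⁻¹ ^ 2) ^ k / ν := by gcongr
              _ = _ := by ring
        _ ≤ M * ((r : ℝ) ^ (-ν - 1) / ν * ((r : ℝ)⁻¹ ^ 2) ^ k) := by
            rw [← Finset.sum_mul]
            gcongr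
            exact hsum.sum_le_tsum _ fun i _ => by positivity
        _ = _ := by ring
    have h2 : ‖∫ x in (0 : ℝ)..r, T k x‖
        ≤ C * (r : ℝ)⁻¹ ^ 2 * ((r : ℝ) ^ (1 - ν) / (1 - ν)) * ((r : ℝ)⁻¹ ^ 2) ^ k := by
      refine (intervalIntegral.norm_integral_le_of_norm_le hr.le
        (Eventually.of_forall fun x hx => hTb k x hx.1 hx.2)
        ((intervalIntegral.intervalIntegrable_rpow' (r := -ν) (by linarith)).const_mul _)).trans_eq ?_
      rw [intervalIntegral.integral_const_mul, integral_rpow (Or.inl (by linarith)),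
        Real.zero_rpow (by linarith), sub_zero, pow_add, pow_mul]
      rw [show -ν + 1 = 1 - ν by ring]
      ring
    refine (norm_add_le _ _).trans ((add_le_add h1 h2).trans_eq ?_)
    ring

/-! ### Tangent integral and principal values of powers -/

/-- With `x = (1+t)/2` this is the Mittag-Leffler expansion of `π cot(πx)`, regrouped, and `cot(πx)
= -tan(πt/2)`. -/
theorem hasSum_inv_sub_inv_eq_tan {t : ℝ} (ht : |t| < 1) {S : ℝ}
    (hS : HasSum (fun j : ℕ => 1 / (2 * (j : ℝ) + 1 + t) - 1 / (2 * (j : ℝ) + 1 - t)) S) :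
    S = -(Real.pi / 2) * Real.tan (Real.pi * t / 2) := by
  obtain ⟨ht1, ht2⟩ := abs_lt.1 ht
  set x : ℝ := (1 + t) / 2 with hx
  have hx0 : 0 < x := by rw [hx]; linarith
  have hx1 : x < 1 := by rw [hx]; linarith
  have hxZ : (x : ℂ) ∈ Complex.integerComplement := by
    rintro ⟨n, hn⟩
    have hn : (n : ℝ) = x := by exact_mod_cast hn
    rw [← hn] at hx0 hx1
    have h0 : 0 < n := by exact_mod_cast hx0
    have h1 : n < 1 := by exact_mod_cast hx1
    omega
  have h1 := (summable_cotTerm hxZ).hasSum.tendsto_sum_nat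
  have h2 : ∑' n, cotTerm (x : ℂ) n = Real.pi * Complex.cot (Real.pi * x) - 1 / x :=
    (cot_series_rep' hxZ).symm
  rw [h2] at h1
  have h3 : Tendsto (fun N : ℕ => (1 / (x + N) : ℝ)) atTop (𝓝 0) :=
    Tendsto.div_atTop tendsto_const_nhds
      (tendsto_const_nhds.add_atTop tendsto_natCast_atTop_atTop)
  have h3 := (Complex.continuous_ofReal.tendsto (0 : ℝ)).comp h3
  have h4 : Tendsto (fun N : ℕ => ((∑ j ∈ Finset.range N,
      2 * (1 / (2 * (j : ℝ) + 1 + t) - 1 / (2 * (j : ℝ) + 1 - t)) : ℝ) : ℂ)) atTop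
      (𝓝 ((2 * S : ℝ) : ℂ)) :=
    (Complex.continuous_ofReal.tendsto _).comp (hS.mul_left 2).tendsto_sum_nat
  -- Here `1/(x+j)` is paired with `1/(x-(j+1))`, whereas `cotTerm` pairs `1/(x+j+1)` with it.
  -- Partial sums thus differ by `1/x - 1/(x+N)`.
  have h5 := tendsto_nhds_unique h4 (((h1.const_add (1 / (x : ℂ))).sub h3).congr fun N => ?_)
  · rw [Complex.ofReal_zero, sub_zero, add_sub_cancel] at h5
    have h6 : (2 * S : ℝ) = Real.pi * Real.cot (Real.pi * x) := by
      exact_mod_cast h5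
    have h7 : Real.cot (Real.pi * x) = -Real.tan (Real.pi * t / 2) := by
      rw [show Real.pi * x = Real.pi * t / 2 + Real.pi / 2 by rw [hx]; ring,
        Real.cot_eq_cos_div_sin, Real.cos_add_pi_div_two, Real.sin_add_pi_div_two,
        Real.tan_eq_sin_div_cos, neg_div]
    rw [h7] at h6
    linarith
  · simp only [Function.comp_apply]
    induction N with
    | zero => simp
    | succ N ih =>
      rw [Finset.sum_range_succ, Finset.sum_range_succ, Complex.ofReal_add, ← ih]
      have e1 : x + N ≠ 0 := by positivity
      have e2 : x + (N + 1) ≠ 0 := by positivity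
      have e3 : x - (N + 1) ≠ 0 := by
        have : (0 : ℝ) ≤ N := by positivity
        linarith
      have e4 : 2 * (N : ℝ) + 1 + t = 2 * (x + N) := by rw [hx]; ring
      have e5 : 2 * (N : ℝ) + 1 - t = 2 * -(x - (N + 1)) := by rw [hx]; ring
      rw [e4, e5]
      have e1' : (x : ℂ) + N ≠ 0 := by exact_mod_cast e1
      have e2' : (x : ℂ) + (N + 1) ≠ 0 := by exact_mod_cast e2
      have e3' : (x : ℂ) - (N + 1) ≠ 0 := by exact_mod_cast e3
      have e6 : cotTerm (x : ℂ) N = 1 / (x - (N + 1)) + 1 / (x + (N + 1)) := rfl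
      rw [e6]
      push_cast
      field_simp
      ring

/-- For `0 ≤ s < 1`, `x^(-s) - x^s = x^(-s)(1 - x^(2s))` and `x^(2s) ≥ x²`. The factor `1 - x²`
cancels the pole at `1`. -/
theorem abs_rpow_sub_rpow_neg_le {t x : ℝ} (ht : |t| < 1) (hx0 : 0 < x) (hx1 : x ≤ 1) :
    |x ^ t - x ^ (-t)| ≤ x ^ (-|t|) * (1 - x ^ 2) := by
  have key : ∀ s : ℝ, 0 ≤ s → s < 1 → |x ^ s - x ^ (-s)| ≤ x ^ (-s) * (1 - x ^ 2) := by
    intro s hs0 hs1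
    have h1 : x ^ s ≤ x ^ (-s) := Real.rpow_le_rpow_of_exponent_ge hx0 hx1 (by linarith)
    have h2 : x ^ s = x ^ (-s) * x ^ (2 * s) := by rw [← Real.rpow_add hx0]; congr 1; ring
    have h3 : x ^ (2 : ℕ) ≤ x ^ (2 * s) := by
      rw [← Real.rpow_natCast]
      exact Real.rpow_le_rpow_of_exponent_ge hx0 hx1 (by push_cast; linarith)
    rw [abs_of_nonpos (by linarith), h2]
    have h4 : 0 < x ^ (-s) := Real.rpow_pos_of_pos hx0 _
    nlinarith
  obtain ⟨ht1, ht2⟩ := abs_lt.1 ht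
  rcases le_total 0 t with h | h
  · rw [abs_of_nonneg h]; exact key t h ht2
  · have := key (-t) (by linarith) (by linarith)
    rwa [abs_of_nonpos h, abs_sub_comm, ← neg_neg t, neg_neg (-t)]

theorem intervalIntegrable_rpow_sub_div {t : ℝ} (ht : |t| < 1) :
    IntervalIntegrable (fun x : ℝ => (x ^ t - x ^ (-t)) / (1 - x ^ 2)) volume 0 1 := by
  refine IntervalIntegrable.mono_fun'
    (intervalIntegral.intervalIntegrable_rpow' (r := -|t|) (by linarith)) ?_ ?_
  · exact Measurable.aestronglyMeasurable (by fun_prop)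
  · rw [Set.uIoc_of_le zero_le_one]
    refine (ae_restrict_iff' measurableSet_Ioc).2 (Eventually.of_forall fun x hx => ?_)
    have h0 : 0 ≤ 1 - x ^ 2 := by nlinarith [hx.1, hx.2]
    beta_reduce
    rw [norm_div, Real.norm_eq_abs, Real.norm_of_nonneg h0]
    exact div_le_of_le_mul₀ h0 (Real.rpow_nonneg hx.1.le _) (abs_rpow_sub_rpow_neg_le ht hx.1 hx.2)

/-- The geometric series of `1/(1-x²)` is integrated termwise. The majorants `x^(-|t|)(1-x²)x^(2j)`
sum to exactly `x^(-|t|)`, which is integrable. -/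
theorem integral_rpow_sub_div {t : ℝ} (ht : |t| < 1) :
    ∫ x in (0 : ℝ)..1, (x ^ t - x ^ (-t)) / (1 - x ^ 2)
      = -(Real.pi / 2) * Real.tan (Real.pi * t / 2) := by
  obtain ⟨ht1, ht2⟩ := abs_lt.1 ht
  have hne : ∀ᵐ x : ℝ, x ≠ 1 := by simp [ae_iff]
  have hgeom : ∀ x : ℝ, 0 < x → x < 1 →
      HasSum (fun j : ℕ => (x ^ 2) ^ j) (1 - x ^ 2)⁻¹ := fun x h0 h1 =>
    hasSum_geometric_of_lt_one (by positivity) (by nlinarith)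
  have hb : ∀ x : ℝ, 0 < x → x < 1 →
      HasSum (fun j : ℕ => x ^ (-|t|) * (1 - x ^ 2) * (x ^ 2) ^ j) (x ^ (-|t|)) := by
    intro x h0 h1
    have := (hgeom x h0 h1).mul_left (x ^ (-|t|) * (1 - x ^ 2))
    have h2 : 1 - x ^ 2 ≠ 0 := by nlinarith
    rwa [mul_inv_cancel_right₀ h2] at this
  have h := intervalIntegral.hasSum_integral_of_dominated_convergence (a := 0) (b := 1)
    (μ := volume) (F := fun (j : ℕ) (x : ℝ) => (x ^ t - x ^ (-t)) * (x ^ 2) ^ j)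
    (f := fun x : ℝ => (x ^ t - x ^ (-t)) / (1 - x ^ 2))
    (fun j x => x ^ (-|t|) * (1 - x ^ 2) * (x ^ 2) ^ j) ?_ ?_ ?_ ?_ ?_
  · refine hasSum_inv_sub_inv_eq_tan ht (h.congr_fun ?_)
    intro j
    have e : ∀ s : ℝ, -1 < s → ∫ x in (0 : ℝ)..1, x ^ s = 1 / (s + 1) := fun s hs => by
      rw [integral_rpow (Or.inl hs), Real.one_rpow, Real.zero_rpow (by linarith), sub_zero]
    have hj : (0 : ℝ) ≤ j := by positivity
    have e1 : ∫ x in (0 : ℝ)..1, (x ^ t - x ^ (-t)) * (x ^ 2) ^ j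
        = ∫ x in (0 : ℝ)..1, (x ^ (2 * (j : ℝ) + t) - x ^ (2 * (j : ℝ) - t)) := by
      refine intervalIntegral.integral_congr_ae (Eventually.of_forall fun x hx => ?_)
      rw [Set.uIoc_of_le zero_le_one] at hx
      rw [sub_mul, ← pow_mul, ← Real.rpow_natCast x (2 * j), ← Real.rpow_add hx.1,
        ← Real.rpow_add hx.1]
      push_cast
      ring_nf
    rw [e1, intervalIntegral.integral_sub
      (intervalIntegral.intervalIntegrable_rpow' (by linarith))
      (intervalIntegral.intervalIntegrable_rpow' (by linarith)), e _ (by linarith),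
      e _ (by linarith)]
    ring
  · exact fun j => Measurable.aestronglyMeasurable (by fun_prop)
  · refine fun j => Eventually.of_forall fun x hx => ?_
    rw [Set.uIoc_of_le zero_le_one] at hx
    rw [norm_mul, Real.norm_eq_abs, Real.norm_of_nonneg (by positivity : 0 ≤ (x ^ 2) ^ j)]
    exact mul_le_mul_of_nonneg_right (abs_rpow_sub_rpow_neg_le ht hx.1 hx.2) (by positivity)
  · filter_upwards [hne] with x hx1 hx
    rw [Set.uIoc_of_le zero_le_one] at hx
    exact (hb x hx.1 (lt_of_le_of_ne hx.2 hx1)).summable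
  · refine (intervalIntegral.intervalIntegrable_rpow' (r := -|t|) (by linarith)).congr_ae ?_
    rw [Set.uIoc_of_le zero_le_one]
    refine (ae_restrict_iff' measurableSet_Ioc).2 ?_
    filter_upwards [hne] with x hx1 hx
    exact (hb x hx.1 (lt_of_le_of_ne hx.2 hx1)).tsum_eq.symm
  · filter_upwards [hne] with x hx1 hx
    rw [Set.uIoc_of_le zero_le_one] at hx
    simpa [div_eq_mul_inv] using
      (hgeom x hx.1 (lt_of_le_of_ne hx.2 hx1)).mul_left (x ^ t - x ^ (-t))

theorem intervalIntegrable_rpow_div_one_sub_sq {t y : ℝ} (ht : -1 < t) (hy0 : 0 ≤ y) (hy : y < 1) :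
    IntervalIntegrable (fun x : ℝ => x ^ t / (1 - x ^ 2)) volume 0 y := by
  simp only [div_eq_mul_inv]
  refine (intervalIntegral.intervalIntegrable_rpow' ht).mul_continuousOn ?_
  rw [Set.uIcc_of_le hy0]
  refine ContinuousOn.inv₀ (by fun_prop) fun x hx => ?_
  nlinarith [hx.1, hx.2]

theorem hasSum_integral_rpow_div_one_sub_sq {t y : ℝ} (ht : -1 < t) (hy0 : 0 < y) (hy : y < 1) :
    HasSum (fun k : ℕ => y ^ (2 * (k : ℝ) + 1 + t) / (2 * k + 1 + t))
      (∫ x in (0 : ℝ)..y, x ^ t / (1 - x ^ 2)) := by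
  have hgeom : ∀ x : ℝ, 0 < x → x ≤ y →
      HasSum (fun j : ℕ => x ^ t * (x ^ 2) ^ j) (x ^ t / (1 - x ^ 2)) := fun x h0 h1 => by
    rw [div_eq_mul_inv]
    exact (hasSum_geometric_of_lt_one (by positivity) (by nlinarith)).mul_left _
  have h := intervalIntegral.hasSum_integral_of_dominated_convergence (a := 0) (b := y)
    (μ := volume) (F := fun (j : ℕ) (x : ℝ) => x ^ t * (x ^ 2) ^ j)
    (f := fun x : ℝ => x ^ t / (1 - x ^ 2))
    (fun j x => x ^ t * (x ^ 2) ^ j) ?_ ?_ ?_ ?_ ?_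
  · refine h.congr_fun fun j => ?_
    have hj : (0 : ℝ) ≤ j := by positivity
    have e1 : ∫ x in (0 : ℝ)..y, x ^ t * (x ^ 2) ^ j = ∫ x in (0 : ℝ)..y, x ^ (2 * (j : ℝ) + t) := by
      refine intervalIntegral.integral_congr_ae (Eventually.of_forall fun x hx => ?_)
      rw [Set.uIoc_of_le hy0.le] at hx
      rw [← pow_mul, ← Real.rpow_natCast x (2 * j), ← Real.rpow_add hx.1]
      push_cast
      ring_nf
    rw [e1, integral_rpow (Or.inl (by linarith)), Real.zero_rpow (by linarith)]
    ring_nf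
  · exact fun j => Measurable.aestronglyMeasurable (by fun_prop)
  · refine fun j => Eventually.of_forall fun x hx => ?_
    rw [Set.uIoc_of_le hy0.le] at hx
    have := hx.1
    rw [Real.norm_of_nonneg (by positivity)]
  · refine Eventually.of_forall fun x hx => ?_
    rw [Set.uIoc_of_le hy0.le] at hx
    exact (hgeom x hx.1 hx.2).summable
  · refine (intervalIntegrable_rpow_div_one_sub_sq ht hy0.le hy).congr fun x hx => ?_
    rw [Set.uIoc_of_le hy0.le] at hx
    exact (hgeom x hx.1 hx.2).tsum_eq.symm
  · refine Eventually.of_forall fun x hx => ?_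
    rw [Set.uIoc_of_le hy0.le] at hx
    exact hgeom x hx.1 hx.2

/-- The form `dx/(1-x²)` is invariant under `x ↦ 1/x`. -/
theorem integral_rpow_div_one_sub_sq_inv {t c d : ℝ} (hc : 1 < c) (hcd : c ≤ d) :
    ∫ x in c..d, x ^ t / (1 - x ^ 2) = ∫ u in c⁻¹..d⁻¹, u ^ (-t) / (1 - u ^ 2) := by
  have hpos : ∀ x ∈ Set.uIcc c d, 1 < x := fun x hx => by
    rw [Set.uIcc_of_le hcd] at hx; linarith [hx.1]
  rw [← intervalIntegral.integral_comp_mul_deriv'' (f := fun x => x⁻¹) (f' := fun x => -(x ^ 2)⁻¹)]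
  · refine intervalIntegral.integral_congr fun x hx => ?_
    have h1 := hpos x hx
    have h0 : 0 < x := by linarith
    have h2 : 1 - x ^ 2 ≠ 0 := by nlinarith
    have h3 : x ^ 2 - 1 ≠ 0 := by nlinarith
    simp only [Function.comp_apply]
    rw [Real.inv_rpow h0.le, Real.rpow_neg h0.le, inv_inv]
    rw [show 1 - x⁻¹ ^ 2 = -(1 - x ^ 2) / x ^ 2 by field_simp; ring]
    field_simp
  · exact continuousOn_inv₀.mono fun x hx => by
      have := hpos x hx
      simp only [Set.mem_compl_iff, Set.mem_singleton_iff]; linarith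
  · intro x hx
    rw [min_eq_left hcd] at hx
    exact (hasDerivAt_inv (by linarith [hx.1])).hasDerivWithinAt
  · refine ContinuousOn.neg (ContinuousOn.inv₀ (by fun_prop) fun x hx => ?_)
    have := hpos x hx
    positivity
  · rintro u ⟨x, hx, rfl⟩
    have h1 := hpos x hx
    have h0 : 0 < x⁻¹ := by positivity
    have h2 : x⁻¹ < 1 := inv_lt_one_of_one_lt₀ h1
    refine ContinuousAt.continuousWithinAt (ContinuousAt.div
      (Real.continuousAt_rpow_const _ _ (Or.inl h0.ne')) (by fun_prop) ?_)
    simp only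
    nlinarith

/-- Inversion folds `(1+δ, B)` onto `(B⁻¹, (1+δ)⁻¹)` with reversed orientation. The two singular
integrals then combine into the convergent tangent integral. -/
theorem tendsto_pv_rpow_div_one_sub_sq {t B : ℝ} (ht : |t| < 1) (hB : 1 < B) :
    Tendsto (fun δ : ℝ => (∫ x in (0 : ℝ)..(1 - δ), x ^ t / (1 - x ^ 2))
        + ∫ x in (1 + δ)..B, x ^ t / (1 - x ^ 2)) (𝓝[>] 0)
      (𝓝 (-(Real.pi / 2) * Real.tan (Real.pi * t / 2)
        + ∫ x in (0 : ℝ)..B⁻¹, x ^ (-t) / (1 - x ^ 2))) := by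
  obtain ⟨ht1, ht2⟩ := abs_lt.1 ht
  have hB0 : 0 < B⁻¹ := by positivity
  have hB1 : B⁻¹ < 1 := inv_lt_one_of_one_lt₀ hB
  have hl : Tendsto (fun δ : ℝ => 1 - δ) (𝓝[>] 0) (𝓝[Set.Icc 0 1] 1) := by
    refine tendsto_nhdsWithin_iff.2 ⟨?_, ?_⟩
    · have : Tendsto (fun δ : ℝ => 1 - δ) (𝓝 0) (𝓝 (1 - 0)) := tendsto_const_nhds.sub tendsto_id
      rw [sub_zero] at this
      exact this.mono_left nhdsWithin_le_nhds
    · filter_upwards [Ioo_mem_nhdsGT (zero_lt_one (α := ℝ))] with δ hδ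
      exact ⟨by linarith [hδ.2], by linarith [hδ.1]⟩
  have h1 : Tendsto (fun δ : ℝ => ∫ x in (0 : ℝ)..(1 - δ), (x ^ t - x ^ (-t)) / (1 - x ^ 2))
      (𝓝[>] 0) (𝓝 (-(Real.pi / 2) * Real.tan (Real.pi * t / 2))) := by
    rw [← integral_rpow_sub_div ht]
    have hc := intervalIntegral.continuousOn_primitive_interval (a := 0) (b := 1)
      (f := fun x : ℝ => (x ^ t - x ^ (-t)) / (1 - x ^ 2)) (μ := volume)
      ((intervalIntegrable_iff' (by simp)).1 (intervalIntegrable_rpow_sub_div ht))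
    rw [Set.uIcc_of_le zero_le_one] at hc
    exact (hc 1 (by simp)).tendsto.comp hl
  -- The folded cut `(1+δ)⁻¹` misses `1-δ` by at most `δ²`, where the integrand is at most `4/δ`;
  -- the mismatch is `O(δ)`.
  have h2 : Tendsto (fun δ : ℝ => ∫ x in (1 - δ)..(1 + δ)⁻¹, x ^ (-t) / (1 - x ^ 2))
      (𝓝[>] 0) (𝓝 0) := by
    have h4 : Tendsto (fun δ : ℝ => 4 * δ) (𝓝[>] 0) (𝓝 0) := by
      have : Tendsto (fun δ : ℝ => 4 * δ) (𝓝 0) (𝓝 (4 * 0)) := tendsto_id.const_mul 4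
      rw [mul_zero] at this
      exact this.mono_left nhdsWithin_le_nhds
    refine squeeze_zero_norm' ?_ h4
    filter_upwards [Ioo_mem_nhdsGT (by norm_num : (0 : ℝ) < 1 / 2)] with δ hδ
    obtain ⟨hδ0, hδ1⟩ := hδ
    have hle : 1 - δ ≤ (1 + δ)⁻¹ := by
      rw [le_inv_comm₀ (by linarith) (by linarith), inv_eq_one_div, le_div_iff₀ (by linarith)]
      nlinarith
    have hdiff : (1 + δ)⁻¹ - (1 - δ) ≤ δ ^ 2 := by
      have : (1 + δ)⁻¹ - (1 - δ) = δ ^ 2 / (1 + δ) := by field_simp; ring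
      rw [this, div_le_iff₀ (by linarith)]
      nlinarith [sq_nonneg δ]
    have hb := intervalIntegral.norm_integral_le_of_norm_le_const (a := 1 - δ) (b := (1 + δ)⁻¹)
      (C := 4 / δ) (f := fun x : ℝ => x ^ (-t) / (1 - x ^ 2)) ?_
    · refine hb.trans ?_
      rw [abs_of_nonneg (by linarith)]
      calc 4 / δ * ((1 + δ)⁻¹ - (1 - δ)) ≤ 4 / δ * δ ^ 2 := by gcongr
        _ = 4 * δ := by field_simp
    · intro x hx
      rw [Set.uIoc_of_le hle] at hx
      have hx0 : 1 / 2 < x := by linarith [hx.1]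
      have hx1 : x ≤ 1 - δ / 2 := by
        refine hx.2.trans ?_
        rw [inv_eq_one_div, div_le_iff₀ (by linarith)]
        nlinarith
      have h5 : x ^ (-t) ≤ 2 := by
        calc x ^ (-t) ≤ x ^ (-1 : ℝ) :=
              Real.rpow_le_rpow_of_exponent_ge (by linarith) (by linarith) (by linarith)
          _ ≤ 2 := by
              rw [Real.rpow_neg_one, inv_eq_one_div, div_le_iff₀ (by linarith)]; linarith
      have h6 : δ / 2 ≤ 1 - x ^ 2 := by nlinarith
      rw [Real.norm_of_nonneg (div_nonneg (Real.rpow_nonneg (by linarith) _) (by linarith))]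
      calc x ^ (-t) / (1 - x ^ 2) ≤ 2 / (δ / 2) := by gcongr
        _ = 4 / δ := by field_simp; norm_num
  have h3 := (h1.add_const (∫ x in (0 : ℝ)..B⁻¹, x ^ (-t) / (1 - x ^ 2))).sub h2
  rw [sub_zero] at h3
  refine h3.congr' ?_
  filter_upwards [Ioo_mem_nhdsGT (by linarith : (0 : ℝ) < B - 1),
    Ioo_mem_nhdsGT (zero_lt_one (α := ℝ))] with δ hδB hδ
  obtain ⟨hδ0, hδ1⟩ := hδ
  have i1 := intervalIntegrable_rpow_div_one_sub_sq (y := 1 - δ) ht1 (by linarith) (by linarith)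
  have i2 := intervalIntegrable_rpow_div_one_sub_sq (t := -t) (y := 1 - δ) (by linarith)
    (by linarith) (by linarith)
  have i3 := intervalIntegrable_rpow_div_one_sub_sq (t := -t) (y := (1 + δ)⁻¹) (by linarith)
    (by positivity) (inv_lt_one_of_one_lt₀ (by linarith))
  have i4 := intervalIntegrable_rpow_div_one_sub_sq (t := -t) (y := B⁻¹) (by linarith)
    hB0.le hB1
  rw [integral_rpow_div_one_sub_sq_inv (c := 1 + δ) (d := B) (by linarith) (by linarith [hδB.2])]
  simp only [sub_div]
  rw [intervalIntegral.integral_sub i1 i2, ← intervalIntegral.integral_interval_sub_left i3 i2,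
    ← intervalIntegral.integral_interval_sub_left i4 i3]
  ring

/-- The summands are `ω^(2k+1)` times the finite parts of `x^(t-2k-2)`. Thus `t = -ν` and `t = 1-ν`
are the theorem for `f = 1` and `f = z`. Rescaling by `ω` reduces to a pole at `1`. -/
theorem exists_hasPVTo_rpow {t ω b : ℝ} (ht : |t| < 1) (hω : 0 < ω) (hb : ω < b) :
    ∃ S : ℝ, HasSum (fun k : ℕ => ω ^ (2 * k + 1) *
        (b ^ (t - (2 * (k : ℝ) + 1)) / (t - (2 * (k : ℝ) + 1)))) S ∧
      HasPVTo (fun x : ℝ => ((ω * x ^ t / (ω ^ 2 - x ^ 2) : ℝ) : ℂ)) ω b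
        ((-S - Real.pi / 2 * ω ^ t * Real.tan (Real.pi * t / 2) : ℝ) : ℂ) := by
  obtain ⟨ht1, ht2⟩ := abs_lt.1 ht
  have hb0 : 0 < b := hω.trans hb
  have hB : 1 < b / ω := (one_lt_div hω).2 hb
  have hs := hasSum_integral_rpow_div_one_sub_sq (t := -t) (y := (b / ω)⁻¹) (by linarith)
    (by positivity) (inv_lt_one_of_one_lt₀ hB)
  refine ⟨-(ω ^ t * ∫ x in (0 : ℝ)..(b / ω)⁻¹, x ^ (-t) / (1 - x ^ 2)), ?_, ?_, ?_⟩
  · refine (hs.mul_left (ω ^ t)).neg.congr_fun fun k => ?_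
    have h1 : ((b / ω)⁻¹ : ℝ) ^ (2 * (k : ℝ) + 1 + -t)
        = ω ^ (2 * k + 1) * ω ^ (-t) * b ^ (t - (2 * (k : ℝ) + 1)) := by
      rw [inv_div, Real.div_rpow hω.le hb0.le, div_eq_mul_inv, ← Real.rpow_neg hb0.le,
        Real.rpow_add hω, ← Real.rpow_natCast ω (2 * k + 1)]
      push_cast
      ring_nf
    have h2 : t - (2 * (k : ℝ) + 1) = -(2 * k + 1 + -t) := by ring
    have h3 : ω ^ t * ω ^ (-t) = 1 := by rw [← Real.rpow_add hω]; simp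
    have h5 : ∀ X : ℝ, X / (t - (2 * (k : ℝ) + 1)) = -(X / (2 * k + 1 + -t)) := fun X => by
      rw [h2, div_neg]
    rw [h1, h5]
    linear_combination (ω ^ (2 * k + 1) * b ^ (t - (2 * (k : ℝ) + 1)) / (2 * k + 1 + -t)) * h3
  · filter_upwards [eventually_lt_sub_add_lt hω hb] with ε hε
    constructor
    · refine IntervalIntegrable.ofReal_comp ?_
      have : (fun x : ℝ => ω * x ^ t / (ω ^ 2 - x ^ 2))
          = fun x => x ^ t * (ω / (ω ^ 2 - x ^ 2)) := by ext x; ring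
      rw [this]
      refine (intervalIntegral.intervalIntegrable_rpow' ht1).mul_continuousOn ?_
      rw [Set.uIcc_of_le hε.2.1.le]
      refine ContinuousOn.div (by fun_prop) (by fun_prop) fun x hx => ?_
      nlinarith [hx.1, hx.2]
    · refine IntervalIntegrable.ofReal_comp (ContinuousOn.intervalIntegrable fun x hx => ?_)
      rw [Set.uIcc_of_le hε.2.2.le] at hx
      refine ContinuousAt.continuousWithinAt (ContinuousAt.div (ContinuousAt.mul continuousAt_const
        (Real.continuousAt_rpow_const _ _ (Or.inl ?_))) (by fun_prop) ?_)
      · linarith [hx.1]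
      · nlinarith [hx.1, hx.2]
  · have hscale : ∀ c d : ℝ, 0 ≤ c → c ≤ d → ∫ x in (ω * c)..(ω * d), ω * x ^ t / (ω ^ 2 - x ^ 2)
        = ω ^ t * ∫ x in c..d, x ^ t / (1 - x ^ 2) := by
      intro c d hc hcd
      rw [← intervalIntegral.mul_integral_comp_mul_left, ← intervalIntegral.integral_const_mul,
        ← intervalIntegral.integral_const_mul]
      refine intervalIntegral.integral_congr fun x hx => ?_
      rw [Set.uIcc_of_le hcd] at hx
      rw [Real.mul_rpow hω.le (hc.trans hx.1), show ω ^ 2 - (ω * x) ^ 2 = ω ^ 2 * (1 - x ^ 2) by ring]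
      field_simp
    have hδ : Tendsto (fun ε : ℝ => ε / ω) (𝓝[>] 0) (𝓝[>] 0) := by
      refine tendsto_nhdsWithin_iff.2 ⟨?_, ?_⟩
      · have : Tendsto (fun ε : ℝ => ε / ω) (𝓝 0) (𝓝 (0 / ω)) := tendsto_id.div_const ω
        rw [zero_div] at this
        exact this.mono_left nhdsWithin_le_nhds
      · filter_upwards [self_mem_nhdsWithin] with ε hε
        exact div_pos hε hω
    have hlim := ((tendsto_pv_rpow_div_one_sub_sq ht hB).comp hδ).const_mul (ω ^ t)
    have hlim := (Complex.continuous_ofReal.tendsto _).comp hlim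
    convert hlim.congr' ?_ using 2
    · congr 1; ring
    · filter_upwards [eventually_lt_sub_add_lt hω hb] with ε hε
      obtain ⟨h0, h1, h2⟩ := hε
      simp only [Function.comp_apply]
      rw [mul_add, ← hscale _ _ le_rfl (by rw [sub_nonneg, div_le_one hω]; linarith),
        ← hscale _ _ (by positivity) (by rw [le_div_iff₀ hω, add_mul, div_mul_cancel₀ _ hω.ne']; linarith),
        Complex.ofReal_add, intervalIntegral.integral_ofReal, intervalIntegral.integral_ofReal,
        mul_zero, mul_sub, mul_add, mul_div_cancel₀ _ hω.ne', mul_div_cancel₀ _ hω.ne', mul_one]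

theorem inv_sin_sub_cot {ν : ℝ} (hν0 : 0 < ν) (hν1 : ν < 1) :
    1 / Real.sin (Real.pi * ν) - Real.cot (Real.pi * ν) = Real.tan (Real.pi * ν / 2) ∧
    1 / Real.sin (Real.pi * ν) + Real.cot (Real.pi * ν) = Real.tan (Real.pi * (1 - ν) / 2) := by
  have hpi := Real.pi_pos
  have hs : 0 < Real.sin (Real.pi * ν / 2) :=
    Real.sin_pos_of_pos_of_lt_pi (by positivity) (by nlinarith)
  have hc : 0 < Real.cos (Real.pi * ν / 2) :=
    Real.cos_pos_of_mem_Ioo ⟨by nlinarith, by nlinarith⟩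
  have h1 := Real.sin_sq_add_cos_sq (Real.pi * ν / 2)
  rw [show Real.pi * (1 - ν) / 2 = Real.pi / 2 - Real.pi * ν / 2 by ring, Real.tan_pi_div_two_sub,
    Real.cot_eq_cos_div_sin, Real.tan_eq_sin_div_cos,
    show Real.pi * ν = 2 * (Real.pi * ν / 2) by ring, Real.sin_two_mul, Real.cos_two_mul,
    show 2 * (Real.pi * ν / 2) / 2 = Real.pi * ν / 2 by ring]
  constructor
  · field_simp; linear_combination (-2) * h1
  · field_simp; ring

/-! ### Removing the poles at `±ω` -/

theorem AnalyticAt.dslope_of_analyticAt {f : ℂ → ℂ} {c z : ℂ} (hc : AnalyticAt ℂ f c)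
    (hz : AnalyticAt ℂ f z) : AnalyticAt ℂ (dslope f c) z := by
  rcases eq_or_ne z c with rfl | hne
  · obtain ⟨s, hs, hd⟩ := hc.exists_mem_nhds_analyticOnNhd
    exact (((Complex.differentiableOn_dslope hs).2 hd.differentiableOn).analyticAt hs)
  · have h : AnalyticAt ℂ (slope f c) z := by
      simp only [slope_fun_def, vsub_eq_sub, smul_eq_mul]
      exact ((analyticAt_id.sub analyticAt_const).inv (sub_ne_zero.2 hne)).mul
        (hz.sub analyticAt_const)
    refine h.congr ?_
    filter_upwards [isOpen_ne.mem_nhds hne] with w hw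
    exact (dslope_of_ne f hw).symm

/-- `A + B z` interpolates `f` at `±w`, so the difference can be divided by both linear factors.
Using `dslope` keeps `q` analytic at `±w` as well. -/
theorem exists_eq_linear_add_sq_sub_sq_mul {f : ℂ → ℂ} {w : ℂ} (hw : w ≠ 0)
    (h1 : AnalyticAt ℂ f w) (h2 : AnalyticAt ℂ f (-w)) :
    ∃ (A B : ℂ) (q : ℂ → ℂ), (∀ z, AnalyticAt ℂ f z → AnalyticAt ℂ q z) ∧
      ∀ z, f z = A + B * z + (z ^ 2 - w ^ 2) * q z := by
  set A := (f w + f (-w)) / 2 with hA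
  set B := (f w - f (-w)) / (2 * w) with hB
  set g : ℂ → ℂ := fun z => f z - (A + B * z) with hg
  have hga : ∀ z, AnalyticAt ℂ f z → AnalyticAt ℂ g z := fun z hz =>
    hz.sub (analyticAt_const.add (analyticAt_const.mul analyticAt_id))
  have hgw : g w = 0 := by
    simp only [hg, hA, hB]; field_simp; ring
  have hgw' : g (-w) = 0 := by
    simp only [hg, hA, hB]; field_simp; ring
  have e1 : ∀ z, g z = (z - w) * dslope g w z := fun z => by
    have := sub_smul_dslope g w z
    rw [hgw, sub_zero, smul_eq_mul] at this
    exact this.symm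
  have e2 : dslope g w (-w) = 0 := by
    have h := e1 (-w)
    rw [hgw'] at h
    have hne : -w - w ≠ 0 := by
      rw [show -w - w = -(2 * w) by ring]
      exact neg_ne_zero.2 (mul_ne_zero two_ne_zero hw)
    exact (mul_eq_zero.1 h.symm).resolve_left hne
  have e3 : ∀ z, dslope g w z = (z + w) * dslope (dslope g w) (-w) z := fun z => by
    have := sub_smul_dslope (dslope g w) (-w) z
    rw [e2, sub_zero, smul_eq_mul, sub_neg_eq_add] at this
    exact this.symm
  refine ⟨A, B, dslope (dslope g w) (-w), fun z hz => ?_, fun z => ?_⟩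
  · exact ((hga w h1).dslope_of_analyticAt (hga _ h2)).dslope_of_analyticAt
      ((hga w h1).dslope_of_analyticAt (hga z hz))
  · have := e1 z
    rw [e3] at this
    simp only [hg] at this ⊢
    linear_combination this

theorem norm_odd_pow_mul_le {ω r C : ℝ} {k : ℕ} {z : ℂ} (hω : 0 < ω)
    (hz : ‖z‖ ≤ C * (r⁻¹ ^ 2) ^ k) :
    ‖(ω : ℂ) ^ (2 * k + 1) * z‖ ≤ ω * C * ((ω / r) ^ 2) ^ k := by
  rw [norm_mul, norm_pow, Complex.norm_real, Real.norm_of_nonneg hω.le]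
  calc ω ^ (2 * k + 1) * ‖z‖ ≤ ω ^ (2 * k + 1) * (C * (r⁻¹ ^ 2) ^ k) := by gcongr
    _ = ω * C * ((ω / r) ^ 2) ^ k := by rw [div_eq_mul_inv, mul_pow, mul_pow]; ring

theorem summable_const_mul_div_sq_pow {ω r : ℝ} (C : ℝ) (hω : 0 < ω) (hr : ω < r) :
    Summable fun k : ℕ => C * ((ω / r) ^ 2) ^ k := by
  have h0 : 0 < r := hω.trans hr
  have h1 : ω / r < 1 := (div_lt_one h0).2 hr
  have h2 : 0 ≤ ω / r := by positivity
  exact (summable_geometric_of_lt_one (by positivity) (by nlinarith)).mul_left C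

theorem continuousAt_comp_ofReal {f : ℂ → ℂ} {x : ℝ} (hf : AnalyticAt ℂ f x) :
    ContinuousAt (fun x : ℝ => f x) x :=
  ContinuousAt.comp (f := fun x : ℝ => (x : ℂ)) (g := f) hf.continuousAt
    Complex.continuous_ofReal.continuousAt

theorem continuousAt_ofReal_rpow {x : ℝ} (p : ℝ) (hx : 0 < x) :
    ContinuousAt (fun x : ℝ => ((x ^ p : ℝ) : ℂ)) x :=
  Complex.continuous_ofReal.continuousAt.comp (Real.continuousAt_rpow_const _ _ (Or.inl hx.ne'))

theorem continuousAt_div_rpow {f : ℂ → ℂ} {x : ℝ} (p : ℝ) (hx : 0 < x) (hf : AnalyticAt ℂ f x) :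
    ContinuousAt (fun x : ℝ => f x / ((x ^ p : ℝ) : ℂ)) x :=
  (continuousAt_comp_ofReal hf).div (continuousAt_ofReal_rpow p hx)
    (by exact_mod_cast (Real.rpow_pos_of_pos hx p).ne')

theorem intervalIntegrable_div_rpow {f : ℂ → ℂ} {r b : ℝ} (p : ℝ) (hr : 0 < r) (hrb : r ≤ b)
    (hf : ∀ x : ℝ, 0 ≤ x → x ≤ b → AnalyticAt ℂ f x) :
    IntervalIntegrable (fun x : ℝ => f x / ((x ^ p : ℝ) : ℂ)) volume r b := by
  refine ContinuousOn.intervalIntegrable fun x hx => ?_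
  rw [Set.uIcc_of_le hrb] at hx
  exact (continuousAt_div_rpow p (hr.trans_le hx.1)
    (hf x (hr.le.trans hx.1) hx.2)).continuousWithinAt

/-! ### The formula for a finite upper limit -/

/-- An `r` between `ω` and `min b ρ` splits the interval. Both pieces are `O(r^(-2k))`, so the
series is dominated by powers of `(ω/r)²`. -/
theorem exists_hasFinitePartTo_summable {f : ℂ → ℂ} {ν ω b ρ : ℝ} (hν0 : 0 < ν) (hν1 : ν < 1)
    (hω : 0 < ω) (hb : ω < b) (hωρ : ω < ρ) (hf : ∀ x : ℝ, 0 ≤ x → x ≤ b → AnalyticAt ℂ f x)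
    (hfρ : ∀ z : ℂ, ‖z‖ < ρ → AnalyticAt ℂ f z) :
    ∃ F : ℕ → ℂ, (∀ k : ℕ, HasFinitePartTo
      (fun x : ℝ => f (x : ℂ) / ((x ^ (2 * (k : ℝ) + ν + 2) : ℝ) : ℂ)) b (F k)) ∧
      Summable fun k : ℕ => (ω : ℂ) ^ (2 * k + 1) * F k := by
  obtain ⟨r, hωr, hr⟩ := exists_between (lt_min hb hωρ)
  have hrb : r < b := hr.trans_le (min_le_left _ _)
  have hrρ : r < ρ := hr.trans_le (min_le_right _ _)
  have hr0 : 0 < r := hω.trans hωr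
  obtain ⟨C, F, hF⟩ := exists_hasFinitePartTo_norm_le hν0 hν1 hr0 hrρ hfρ
  obtain ⟨K, hK⟩ := (isCompact_Icc (a := r) (b := b)).exists_bound_of_continuousOn
    (f := fun x : ℝ => f x / ((x ^ (ν + 2) : ℝ) : ℂ)) fun x hx =>
    (continuousAt_div_rpow _ (hr0.trans_le hx.1)
      (hf x (hr0.le.trans hx.1) hx.2)).continuousWithinAt
  refine ⟨fun k => F k + ∫ x in r..b, f (x : ℂ) / ((x ^ (2 * (k : ℝ) + ν + 2) : ℝ) : ℂ),
    fun k => (hF k).1.extend hr0 hrb.le (intervalIntegrable_div_rpow _ hr0 hrb.le hf), ?_⟩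
  refine Summable.of_norm_bounded
    (summable_const_mul_div_sq_pow (ω * (C + K * (b - r))) hω hωr) fun k => ?_
  refine norm_odd_pow_mul_le hω ?_
  have h1 := intervalIntegral.norm_integral_le_of_norm_le_const (a := r) (b := b)
    (f := fun x : ℝ => f (x : ℂ) / ((x ^ (2 * (k : ℝ) + ν + 2) : ℝ) : ℂ))
    (C := K * (r⁻¹ ^ 2) ^ k) fun x hx => ?_
  · rw [abs_of_pos (sub_pos.2 hrb)] at h1
    refine (norm_add_le _ _).trans ((add_le_add (hF k).2 h1).trans_eq ?_)
    ring
  · rw [Set.uIoc_of_le hrb.le] at hx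
    have hx0 : 0 < x := hr0.trans hx.1
    have e : x ^ (2 * (k : ℝ) + ν + 2) = x ^ (ν + 2) * (x ^ 2) ^ k := by
      rw [← pow_mul, ← Real.rpow_natCast, ← Real.rpow_add hx0]
      push_cast; ring_nf
    have h2 := hK x ⟨hx.1.le, hx.2⟩
    rw [e, Complex.ofReal_mul, ← div_div, norm_div, div_eq_mul_inv, Complex.norm_real,
      Real.norm_of_nonneg (by positivity), ← inv_pow, ← inv_pow]
    have : x⁻¹ ≤ r⁻¹ := by gcongr; exact hx.1.le
    have h3 : 0 ≤ K := (norm_nonneg _).trans h2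
    gcongr

theorem intervalIntegrable_rpow_mul {q : ℂ → ℂ} {p b : ℝ} (hp : -1 < p) (hb : 0 < b)
    (hq : ∀ x : ℝ, 0 ≤ x → x ≤ b → AnalyticAt ℂ q x) :
    IntervalIntegrable (fun x : ℝ => ((x ^ p : ℝ) : ℂ) * q x) volume 0 b := by
  refine (intervalIntegral.intervalIntegrable_rpow' hp).ofReal_comp.mul_continuousOn fun x hx => ?_
  rw [Set.uIcc_of_le hb.le] at hx
  exact (continuousAt_comp_ofReal (hq x hx.1 hx.2)).continuousWithinAt

theorem hasSum_odd_pow_mul_sub {w : ℂ} {G : ℕ → ℂ}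
    (h : Summable fun k : ℕ => w ^ (2 * k + 1) * G k) :
    HasSum (fun k : ℕ => w ^ (2 * k + 1) * (G k + -w ^ 2 * G (k + 1))) (w * G 0) := by
  have h3 := h.hasSum.sub ((hasSum_nat_add_iff' 1).2 h.hasSum)
  simp only [Finset.range_one, Finset.sum_singleton, sub_sub_cancel] at h3
  have h0 : w * G 0 = w ^ (2 * 0 + 1) * G 0 := by simp
  rw [h0]
  refine h3.congr_fun fun k => ?_
  ring

theorem cauchy_term_eq {A B : ℂ} {ν ω : ℝ} (hν0 : 0 < ν) (hν1 : ν < 1) (hω : 0 < ω) :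
    ((Real.pi / (2 * ω ^ ν) : ℝ) : ℂ) * ((A - B * ω) / ((Real.sin (Real.pi * ν) : ℝ) : ℂ)
        - (A + B * ω) * ((Real.cot (Real.pi * ν) : ℝ) : ℂ))
      = -(A * ((Real.pi / 2 * ω ^ (-ν) * Real.tan (Real.pi * -ν / 2) : ℝ) : ℂ)
        + B * ((Real.pi / 2 * ω ^ (1 - ν) * Real.tan (Real.pi * (1 - ν) / 2) : ℝ) : ℂ)) := by
  obtain ⟨t1, t2⟩ := inv_sin_sub_cot hν0 hν1
  rw [show Real.pi * -ν / 2 = -(Real.pi * ν / 2) by ring, Real.tan_neg, ← t1, ← t2,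
    Real.rpow_neg hω.le, Real.rpow_sub hω, Real.rpow_one]
  generalize Real.sin (Real.pi * ν) = s
  generalize Real.cot (Real.pi * ν) = c
  generalize ω ^ ν = y
  push_cast
  ring

/-- Both sides are linear in `f`, so `1`, `z` and `(z² - ω²) q` are treated separately. For the
last, the `k`-th finite part is `G k - ω² G (k+1)` and the series telescopes. -/
theorem exists_hasSum_hasPVTo_parityKernel {f : ℂ → ℂ} {ν ω b ρ : ℝ} (hν0 : 0 < ν) (hν1 : ν < 1)
    (hω : 0 < ω) (hb : ω < b) (hωρ : ω < ρ) (hf : ∀ x : ℝ, 0 ≤ x → x ≤ b → AnalyticAt ℂ f x)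
    (hfρ : ∀ z : ℂ, ‖z‖ < ρ → AnalyticAt ℂ f z) :
    ∃ (F : ℕ → ℂ) (S : ℂ), (∀ k : ℕ, HasFinitePartTo
      (fun x : ℝ => f (x : ℂ) / ((x ^ (2 * (k : ℝ) + ν + 2) : ℝ) : ℂ)) b (F k)) ∧
      HasSum (fun k : ℕ => (ω : ℂ) ^ (2 * k + 1) * F k) S ∧
      HasPVTo (parityKernel f ν ω) ω b
          (-S + ((Real.pi / (2 * ω ^ ν) : ℝ) : ℂ) *
            (f (-(ω : ℂ)) / ((Real.sin (Real.pi * ν) : ℝ) : ℂ)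
              - f (ω : ℂ) * ((Real.cot (Real.pi * ν) : ℝ) : ℂ))) := by
  have hb0 : 0 < b := hω.trans hb
  have hωn : ‖(ω : ℂ)‖ < ρ := by rwa [Complex.norm_real, Real.norm_of_nonneg hω.le]
  have hωC : (ω : ℂ) ≠ 0 := by exact_mod_cast hω.ne'
  obtain ⟨A, B, q, hq, hfq⟩ := exists_eq_linear_add_sq_sub_sq_mul hωC (hfρ _ hωn)
    (hfρ (-ω) (by rwa [norm_neg]))
  have hqb : ∀ x : ℝ, 0 ≤ x → x ≤ b → AnalyticAt ℂ q x := fun x h0 h1 => hq _ (hf x h0 h1)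
  obtain ⟨Q, hQ, hQs⟩ := exists_hasFinitePartTo_summable hν0 hν1 hω hb hωρ hqb
    fun z hz => hq z (hfρ z hz)
  have hi : IntervalIntegrable (fun x : ℝ => ((x ^ (-ν) : ℝ) : ℂ) * q x) volume 0 b :=
    intervalIntegrable_rpow_mul (by linarith) hb0 hqb
  set G0 := ∫ x in (0 : ℝ)..b, ((x ^ (-ν) : ℝ) : ℂ) * q x with hG0
  -- `G k` is the finite part of `q/x^(2k+ν)`: an ordinary integral for `k = 0`, and `Q (k-1)`
  -- afterwards.
  set G : ℕ → ℂ := fun k => Nat.casesOn k G0 Q with hG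
  have hGfp : ∀ k : ℕ, HasFinitePartTo
      (fun x : ℝ => q (x : ℂ) / ((x ^ (2 * (k : ℝ) + ν) : ℝ) : ℂ)) b (G k) := by
    rintro (_ | k)
    · refine (hasFinitePartTo_of_intervalIntegrable hb0 hi).congr hb0 fun x hx _ => ?_
      rw [Nat.cast_zero, mul_zero, zero_add, Real.rpow_neg hx.le, Complex.ofReal_inv, div_eq_mul_inv,
        mul_comm]
    · refine (hQ k).congr hb0 fun x _ _ => ?_
      rw [show 2 * (k : ℝ) + ν + 2 = 2 * ((k + 1 : ℕ) : ℝ) + ν by push_cast; ring]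
  have hGs : HasSum (fun k : ℕ => (ω : ℂ) ^ (2 * k + 1) * (G k + -ω ^ 2 * G (k + 1))) (ω * G0) := by
    have h1 : Summable fun k : ℕ => (ω : ℂ) ^ (2 * k + 1) * G k := by
      rw [← summable_nat_add_iff 1]
      refine (hQs.mul_left ((ω : ℂ) ^ 2)).congr fun k => ?_
      change _ = (ω : ℂ) ^ (2 * (k + 1) + 1) * Q k
      ring
    exact hasSum_odd_pow_mul_sub h1
  have ht0 : |-ν| < 1 := abs_lt.2 ⟨by linarith, by linarith⟩
  have ht1 : |1 - ν| < 1 := abs_lt.2 ⟨by linarith, by linarith⟩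
  obtain ⟨S0, hS0, hP0⟩ := exists_hasPVTo_rpow ht0 hω hb
  obtain ⟨S1, hS1, hP1⟩ := exists_hasPVTo_rpow ht1 hω hb
  have hS0 := Complex.hasSum_ofReal.2 hS0
  have hS1 := Complex.hasSum_ofReal.2 hS1
  refine ⟨fun k => A * ((b ^ (-ν - (2 * (k : ℝ) + 1)) / (-ν - (2 * (k : ℝ) + 1)) : ℝ) : ℂ)
      + B * ((b ^ (1 - ν - (2 * (k : ℝ) + 1)) / (1 - ν - (2 * (k : ℝ) + 1)) : ℝ) : ℂ)
      + (G k + -ω ^ 2 * G (k + 1)), A * S0 + B * S1 + ω * G0, fun k => ?_, ?_, ?_⟩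
  · have hk : (0 : ℝ) ≤ k := by positivity
    have p0 := (hasFinitePartTo_rpow (p := -(2 * (k : ℝ) + ν + 2)) hb0 (by linarith)).const_mul hb0 A
    have p1 := (hasFinitePartTo_rpow (p := 1 - (2 * (k : ℝ) + ν + 2)) hb0
      (by intro h; linarith)).const_mul hb0 B
    rw [show -(2 * (k : ℝ) + ν + 2) + 1 = -ν - (2 * (k : ℝ) + 1) by ring] at p0
    rw [show 1 - (2 * (k : ℝ) + ν + 2) + 1 = 1 - ν - (2 * (k : ℝ) + 1) by ring] at p1
    refine ((p0.add hb0 p1).add hb0 ((hGfp k).add hb0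
      ((hGfp (k + 1)).const_mul hb0 (-ω ^ 2)))).congr hb0 fun x hx _ => ?_
    have hx0 : ((x ^ (2 * (k : ℝ) + ν) : ℝ) : ℂ) ≠ 0 := by
      exact_mod_cast (Real.rpow_pos_of_pos hx _).ne'
    have hxC : (x : ℂ) ≠ 0 := by exact_mod_cast hx.ne'
    have e : x ^ (2 * (k : ℝ) + ν + 2) = x ^ (2 * (k : ℝ) + ν) * x ^ 2 := by
      rw [Real.rpow_add hx]; norm_num
    have e' : 2 * ((k + 1 : ℕ) : ℝ) + ν = 2 * (k : ℝ) + ν + 2 := by push_cast; ring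
    rw [hfq x, e', Real.rpow_neg hx.le, Real.rpow_sub hx, Real.rpow_one, e]
    push_cast
    field_simp
    ring
  · refine (((hS0.mul_left A).add (hS1.mul_left B)).add hGs).congr_fun fun k => ?_
    push_cast
    ring
  · have hP := ((hP0.const_mul A).add (hP1.const_mul B)).add
      ((hasPVTo_of_intervalIntegrable hω hb hi).const_mul (-(ω : ℂ)))
    convert hP.congr (g := parityKernel f ν ω) hω hb ?_ using 1
    · have f1 : f ω = A + B * ω := by rw [hfq]; ring
      have f2 : f (-ω) = A - B * ω := by rw [hfq]; ring
      rw [f1, f2, cauchy_term_eq hν0 hν1 hω]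
      push_cast
      ring
    · intro x hx _ hxω
      have hxν : ((x ^ ν : ℝ) : ℂ) ≠ 0 := by exact_mod_cast (Real.rpow_pos_of_pos hx _).ne'
      have hd : (ω : ℂ) ^ 2 - (x : ℂ) ^ 2 ≠ 0 := by
        have : ω ^ 2 - x ^ 2 ≠ 0 := by
          rw [sq_sub_sq]
          exact mul_ne_zero (by positivity) (sub_ne_zero.2 hxω.symm)
        exact_mod_cast this
      rw [parityKernel, hfq x, Real.rpow_neg hx.le, Real.rpow_sub hx, Real.rpow_one]
      push_cast
      field_simp
      ring

/-! ### The infinite upper limit -/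

/-- Integration by parts uses only a bound on the primitive, as needed for conditional convergence.
The boundary term `b^(-n) M` and the integral term `(r^(-n) - b^(-n)) M` add up to `M r^(-n)`. -/
theorem norm_integral_mul_inv_pow_le {h : ℝ → ℂ} {c r b M : ℝ} (hc0 : 0 ≤ c) (hcr : c < r)
    (hrb : r ≤ b) (hh : ContinuousOn h (Set.Ioi c)) (n : ℕ)
    (hM : ∀ x, r ≤ x → x ≤ b → ‖∫ y in r..x, h y‖ ≤ M) :
    ‖∫ x in r..b, ((x⁻¹ ^ n : ℝ) : ℂ) * h x‖ ≤ M * r⁻¹ ^ n := by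
  have hr0 : 0 < r := hc0.trans_lt hcr
  have hint : ∀ x, r ≤ x → IntervalIntegrable h volume r x := fun x hx => by
    refine (hh.mono fun y hy => ?_).intervalIntegrable
    rw [Set.uIcc_of_le hx] at hy
    exact hcr.trans_le hy.1
  have hderiv : ∀ x, 0 < x → HasDerivAt (fun x : ℝ => x⁻¹ ^ n) (-(n * x⁻¹ ^ (n + 1))) x := by
    intro x hx
    refine ((hasDerivAt_inv hx.ne').pow n).congr_deriv ?_
    rcases n with _ | n
    · simp
    · simp only [Nat.add_sub_cancel]
      rw [pow_succ x⁻¹ (n + 1), pow_succ x⁻¹ n]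
      field_simp
  have hpos : ∀ x ∈ Set.uIcc r b, r ≤ x ∧ x ≤ b := fun x hx => by
    rwa [Set.uIcc_of_le hrb] at hx
  have hui : IntervalIntegrable (fun x : ℝ => -(n * x⁻¹ ^ (n + 1))) volume r b := by
    refine ContinuousOn.intervalIntegrable fun x hx => ?_
    have : x ≠ 0 := (hr0.trans_le (hpos x hx).1).ne'
    refine ContinuousAt.continuousWithinAt ?_
    fun_prop (disch := assumption)
  have hparts := intervalIntegral.integral_mul_deriv_eq_deriv_mul (a := r) (b := b)
    (u := fun x : ℝ => ((x⁻¹ ^ n : ℝ) : ℂ)) (v := fun x => ∫ y in r..x, h y)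
    (u' := fun x : ℝ => ((-(n * x⁻¹ ^ (n + 1)) : ℝ) : ℂ)) (v' := h)
    (fun x hx => (hderiv x (hr0.trans_le (hpos x hx).1)).ofReal_comp)
    (fun x hx => intervalIntegral.integral_hasDerivAt_right (hint x (hpos x hx).1)
      (hh.stronglyMeasurableAtFilter isOpen_Ioi x (hcr.trans_le (hpos x hx).1))
      (hh.continuousAt (Ioi_mem_nhds (hcr.trans_le (hpos x hx).1))))
    hui.ofReal_comp (hint b hrb)
  have hftc : ∫ x in r..b, -(n * x⁻¹ ^ (n + 1)) = b⁻¹ ^ n - r⁻¹ ^ n :=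
    intervalIntegral.integral_eq_sub_of_hasDerivAt
      (fun x hx => hderiv x (hr0.trans_le (hpos x hx).1)) hui
  rw [hparts, intervalIntegral.integral_same, mul_zero, sub_zero]
  have h1 : ‖((b⁻¹ ^ n : ℝ) : ℂ) * ∫ y in r..b, h y‖ ≤ b⁻¹ ^ n * M := by
    have : 0 < b := hr0.trans_le hrb
    rw [norm_mul, Complex.norm_real, Real.norm_of_nonneg (by positivity)]
    gcongr
    exact hM b hrb le_rfl
  have h2 : ‖∫ x in r..b, ((-(n * x⁻¹ ^ (n + 1)) : ℝ) : ℂ) * ∫ y in r..x, h y‖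
      ≤ (r⁻¹ ^ n - b⁻¹ ^ n) * M := by
    refine (intervalIntegral.norm_integral_le_of_norm_le hrb (Eventually.of_forall fun x hx => ?_)
      (hui.const_mul (-M))).trans_eq ?_
    · have : 0 < x := hr0.trans hx.1
      rw [norm_mul, Complex.norm_real, norm_neg, Real.norm_of_nonneg (by positivity)]
      calc _ ≤ (n * x⁻¹ ^ (n + 1)) * M := by
            gcongr
            exact hM x hx.1.le hx.2
        _ = _ := by ring
    · rw [intervalIntegral.integral_const_mul, hftc]; ring
  refine (norm_sub_le _ _).trans ((add_le_add h1 h2).trans_eq ?_)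
  ring

theorem intervalIntegrable_inv_pow_mul {h : ℝ → ℂ} {c x y : ℝ} (hc0 : 0 ≤ c) (hcx : c < x)
    (hxy : x ≤ y) (hh : ContinuousOn h (Set.Ioi c)) (n : ℕ) :
    IntervalIntegrable (fun x : ℝ => ((x⁻¹ ^ n : ℝ) : ℂ) * h x) volume x y := by
  refine ContinuousOn.intervalIntegrable fun z hz => ?_
  rw [Set.uIcc_of_le hxy] at hz
  have hz0 : c < z := hcx.trans_le hz.1
  have hne : z ≠ 0 := (hc0.trans_lt hz0).ne'
  have h1 : ContinuousAt (fun x : ℝ => x⁻¹ ^ n) z := by fun_prop (disch := assumption)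
  exact ((Complex.continuous_ofReal.continuousAt.comp h1).mul
    (hh.continuousAt (Ioi_mem_nhds hz0))).continuousWithinAt

/-- Abel's test: the previous bound applied to tails gives the Cauchy criterion. -/
theorem exists_tendsto_integral_mul_inv_pow {h : ℝ → ℂ} {c r : ℝ} {L : ℂ} (hc0 : 0 ≤ c)
    (hcr : c < r) (hh : ContinuousOn h (Set.Ioi c)) (n : ℕ)
    (hL : Tendsto (fun b => ∫ y in r..b, h y) atTop (𝓝 L)) :
    ∃ E : ℂ, Tendsto (fun b => ∫ x in r..b, ((x⁻¹ ^ n : ℝ) : ℂ) * h x) atTop (𝓝 E) := by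
  have hr0 : 0 < r := hc0.trans_lt hcr
  refine cauchySeq_tendsto_of_complete (Metric.cauchySeq_iff'.2 fun ε hε => ?_)
  have hδ : 0 < ε / 2 * r ^ n := by positivity
  obtain ⟨N, hN⟩ := Metric.cauchySeq_iff'.1 hL.cauchySeq (ε / 2 * r ^ n / 2) (by positivity)
  set N' := max N r with hN'
  have hrN : r ≤ N' := le_max_right _ _
  have hint : ∀ x y, r ≤ x → x ≤ y → IntervalIntegrable h volume x y := fun x y hx hxy => by
    simpa using intervalIntegrable_inv_pow_mul hc0 (hcr.trans_le hx) hxy hh 0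
  refine ⟨N', fun b hb => ?_⟩
  have hb : N' ≤ b := hb
  have i1 := intervalIntegrable_inv_pow_mul hc0 hcr hrN hh n
  have i2 := intervalIntegrable_inv_pow_mul hc0 (hcr.trans_le hrN) hb hh n
  rw [dist_eq_norm, ← intervalIntegral.integral_add_adjacent_intervals i1 i2, add_sub_cancel_left]
  refine (norm_integral_mul_inv_pow_le (M := ε / 2 * r ^ n) hc0 (hcr.trans_le hrN) hb hh n
    fun x hx _ => ?_).trans_lt ?_
  · have e1 := hN x ((le_max_left N r).trans hx)
    have e2 := hN N' (le_max_left N r)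
    rw [← intervalIntegral.integral_interval_sub_left (hint r x le_rfl (hrN.trans hx))
      (hint r N' le_rfl hrN), ← dist_eq_norm]
    refine (dist_triangle_right _ _ (∫ y in r..N, h y)).trans ?_
    linarith
  · have : N'⁻¹ ^ n ≤ r⁻¹ ^ n := by
      have : 0 < N' := hr0.trans_le hrN
      gcongr
    calc ε / 2 * r ^ n * N'⁻¹ ^ n ≤ ε / 2 * r ^ n * r⁻¹ ^ n := by gcongr
      _ = ε / 2 := by rw [inv_pow]; field_simp
      _ < ε := by linarith

theorem exists_norm_integral_le_of_tendsto {h : ℝ → ℂ} {c r : ℝ} {L : ℂ}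
    (hcr : c < r) (hh : ContinuousOn h (Set.Ioi c))
    (hL : Tendsto (fun b => ∫ y in r..b, h y) atTop (𝓝 L)) :
    ∃ M : ℝ, ∀ x, r ≤ x → ‖∫ y in r..x, h y‖ ≤ M := by
  obtain ⟨N, hN⟩ := eventually_atTop.1 (hL.norm.eventually_le_const (lt_add_one ‖L‖))
  have hint : IntervalIntegrable h volume r (max N r) := by
    refine (hh.mono fun y hy => ?_).intervalIntegrable
    rw [Set.uIcc_of_le (le_max_right _ _)] at hy
    exact hcr.trans_le hy.1
  have hc := intervalIntegral.continuousOn_primitive_interval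
    ((intervalIntegrable_iff' (by simp)).1 hint)
  obtain ⟨K, hK⟩ := isCompact_uIcc.exists_bound_of_continuousOn hc
  refine ⟨max K (‖L‖ + 1), fun x hx => ?_⟩
  rcases le_total x (max N r) with h1 | h1
  · refine (hK x ?_).trans (le_max_left _ _)
    rw [Set.uIcc_of_le (le_max_right _ _)]
    exact ⟨hx, h1⟩
  · exact (hN x ((le_max_left _ _).trans h1)).trans (le_max_right _ _)

theorem continuousOn_parityKernel {f : ℂ → ℂ} {ν ω : ℝ} (hω : 0 < ω)
    (hf : ∀ x : ℝ, 0 ≤ x → AnalyticAt ℂ f x) :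
    ContinuousOn (parityKernel f ν ω) (Set.Ioi ω) := by
  intro x hx
  have hx : ω < x := hx
  have hx0 : 0 < x := hω.trans hx
  refine ContinuousAt.continuousWithinAt (ContinuousAt.div
    (continuousAt_const.mul (continuousAt_comp_ofReal (hf x hx0.le)))
    (Complex.continuous_ofReal.continuousAt.comp
      ((Real.continuousAt_rpow_const _ _ (Or.inl hx0.ne')).mul (by fun_prop))) ?_)
  have h1 : x ^ ν ≠ 0 := (Real.rpow_pos_of_pos hx0 _).ne'
  have h2 : ω ^ 2 - x ^ 2 ≠ 0 := by nlinarith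
  exact_mod_cast mul_ne_zero h1 h2

theorem exists_tendsto_integral_parityKernel {f : ℂ → ℂ} {ν ω r ρ : ℝ} (hν0 : 0 < ν) (hν1 : ν < 1)
    (hω : 0 < ω) (hr : ω < r) (hωρ : ω < ρ) (hf : ∀ x : ℝ, 0 ≤ x → AnalyticAt ℂ f x)
    (hfρ : ∀ z : ℂ, ‖z‖ < ρ → AnalyticAt ℂ f z)
    (h : (∃ I : ℂ, HasPVUpTo (parityKernel f ν ω) ω ⊤ I) ∨
      IntegrableAtFilter (fun x : ℝ => f (x : ℂ) / ((x ^ (2 + ν) : ℝ) : ℂ)) atTop volume) :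
    ∃ L : ℂ, Tendsto (fun b => ∫ x in r..b, parityKernel f ν ω x) atTop (𝓝 L) := by
  have hr0 : 0 < r := hω.trans hr
  have hcont := continuousOn_parityKernel (ν := ν) hω hf
  rcases h with ⟨I, ⟨b, hb, -⟩ | ⟨-, P, hP, hPI⟩⟩ | hint
  · exact absurd hb (by simp)
  · obtain ⟨p, hpr⟩ : ∃ p, HasPVTo (parityKernel f ν ω) ω r p := by
      obtain ⟨_, _, -, -, hpr⟩ := exists_hasSum_hasPVTo_parityKernel hν0 hν1 hω hr hωρ
        (fun x h0 _ => hf x h0) hfρ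
      exact ⟨_, hpr⟩
    refine ⟨I - p, (hPI.sub_const p).congr' ?_⟩
    filter_upwards [hP, eventually_ge_atTop r] with b hb hrb
    rw [hpr.eq_add_integral hb, add_sub_cancel_left]
    refine (hcont.mono fun y hy => ?_).intervalIntegrable
    rw [Set.uIcc_of_le hrb] at hy
    exact hr.trans_le hy.1
  · obtain ⟨s, hs, hint⟩ := hint
    obtain ⟨N, hN⟩ := mem_atTop_sets.1 hs
    have h1 : IntegrableOn (fun x : ℝ => f (x : ℂ) / ((x ^ (2 + ν) : ℝ) : ℂ)) (Set.Ioi r) := by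
      have h2 := intervalIntegrable_div_rpow (2 + ν) hr0 (le_max_left r N) fun x h0 _ => hf x h0
      have h3 := (intervalIntegrable_iff_integrableOn_Ioc_of_le (le_max_left r N)).1 h2
      have h4 : IntegrableOn (fun x : ℝ => f (x : ℂ) / ((x ^ (2 + ν) : ℝ) : ℂ))
          (Set.Ioi (max r N)) := hint.mono_set fun x hx => hN x ((le_max_right r N).trans hx.le)
      rw [← Set.Ioc_union_Ioi_eq_Ioi (le_max_left r N)]
      exact h3.union h4
    refine ⟨_, intervalIntegral_tendsto_integral_Ioi r ?_ tendsto_id⟩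
    -- The constant comes from `x²/(x²-ω²) ≤ r²/(r²-ω²)` for `x ≥ r`.
    refine Integrable.mono' (h1.norm.const_mul (ω * r ^ 2 / (r ^ 2 - ω ^ 2)))
      ((hcont.mono fun y hy => hr.trans hy).aestronglyMeasurable measurableSet_Ioi)
      ((ae_restrict_iff' measurableSet_Ioi).2 (Eventually.of_forall fun x hx => ?_))
    have hx : r < x := hx
    have hx0 : 0 < x := hr0.trans hx
    have hr2 : 0 < r ^ 2 - ω ^ 2 := by nlinarith
    have hx2 : 0 < x ^ 2 - ω ^ 2 := by nlinarith
    have hxν : 0 < x ^ ν := Real.rpow_pos_of_pos hx0 _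
    have e1 : x ^ (2 + ν) = x ^ 2 * x ^ ν := by rw [Real.rpow_add hx0]; norm_num
    rw [parityKernel, norm_div, norm_mul, norm_div, Complex.norm_real, Complex.norm_real,
      Complex.norm_real, e1, Real.norm_of_nonneg hω.le,
      Real.norm_of_nonneg (by positivity : 0 ≤ x ^ 2 * x ^ ν),
      Real.norm_of_nonpos (by nlinarith : x ^ ν * (ω ^ 2 - x ^ 2) ≤ 0), ← mul_div_assoc,
      div_mul_eq_mul_div, div_div,
      show -(x ^ ν * (ω ^ 2 - x ^ 2)) = x ^ ν * (x ^ 2 - ω ^ 2) by ring,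
      div_le_div_iff₀ (by positivity) (by positivity)]
    have h5 : x ^ 2 * (r ^ 2 - ω ^ 2) ≤ r ^ 2 * (x ^ 2 - ω ^ 2) := by
      have h6 : 0 ≤ ω ^ 2 * (x ^ 2 - r ^ 2) := mul_nonneg (sq_nonneg _) (by nlinarith)
      linarith
    calc _ = (ω * ‖f x‖ * x ^ ν) * (x ^ 2 * (r ^ 2 - ω ^ 2)) := by ring
      _ ≤ (ω * ‖f x‖ * x ^ ν) * (r ^ 2 * (x ^ 2 - ω ^ 2)) := by gcongr
      _ = _ := by ring

/-- The interval is cut at `r` in `(ω, ρ)`. The tails of the finite parts are expressed through the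
kernel, whose primitive is bounded, so they inherit a bound geometric in `k` and uniform in `b`. -/
theorem exists_hasSum_hasPVUpTo_top {f : ℂ → ℂ} {ν ω ρ : ℝ} (hν0 : 0 < ν) (hν1 : ν < 1)
    (hω : 0 < ω) (hωρ : ω < ρ) (hf : ∀ x : ℝ, 0 ≤ x → AnalyticAt ℂ f x)
    (hfρ : ∀ z : ℂ, ‖z‖ < ρ → AnalyticAt ℂ f z)
    (h : (∃ I : ℂ, HasPVUpTo (parityKernel f ν ω) ω ⊤ I) ∨
      IntegrableAtFilter (fun x : ℝ => f (x : ℂ) / ((x ^ (2 + ν) : ℝ) : ℂ)) atTop volume) :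
    ∃ (F : ℕ → ℂ) (S : ℂ), (∀ k : ℕ, HasFinitePartUpTo
      (fun x : ℝ => f (x : ℂ) / ((x ^ (2 * (k : ℝ) + ν + 2) : ℝ) : ℂ)) ⊤ (F k)) ∧
      HasSum (fun k : ℕ => (ω : ℂ) ^ (2 * k + 1) * F k) S ∧
      HasPVUpTo (parityKernel f ν ω) ω ⊤
          (-S + ((Real.pi / (2 * ω ^ ν) : ℝ) : ℂ) *
            (f (-(ω : ℂ)) / ((Real.sin (Real.pi * ν) : ℝ) : ℂ)
              - f (ω : ℂ) * ((Real.cot (Real.pi * ν) : ℝ) : ℂ))) := by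
  obtain ⟨r, hr, hrρ⟩ := exists_between hωρ
  have hr0 : 0 < r := hω.trans hr
  have hcont := continuousOn_parityKernel (ν := ν) hω hf
  obtain ⟨L, hL⟩ := exists_tendsto_integral_parityKernel hν0 hν1 hω hr hωρ hf hfρ h
  obtain ⟨M, hM⟩ := exists_norm_integral_le_of_tendsto hr hcont hL
  obtain ⟨C, F, hF⟩ := exists_hasFinitePartTo_norm_le hν0 hν1 hr0 hrρ hfρ
  set A : ℕ → ℝ → ℂ := fun n b => ∫ x in r..b, ((x⁻¹ ^ n : ℝ) : ℂ) * parityKernel f ν ω x with hA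
  set e : ℕ → ℝ → ℂ := fun k b =>
    ∫ x in r..b, f (x : ℂ) / ((x ^ (2 * (k : ℝ) + ν + 2) : ℝ) : ℂ) with he
  -- Pointwise, `f/x^(2k+ν+2) = ω⁻¹ (ω² x^(-2k-2) - x^(-2k))` times the kernel.
  have heA : ∀ k b, r ≤ b → e k b = (ω : ℂ)⁻¹ * (ω ^ 2 * A (2 * k + 2) b - A (2 * k) b) := by
    intro k b hb
    have i1 := intervalIntegrable_inv_pow_mul hω.le hr hb hcont (2 * k + 2)
    have i2 := intervalIntegrable_inv_pow_mul hω.le hr hb hcont (2 * k)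
    simp only [hA, he]
    rw [← intervalIntegral.integral_const_mul, ← intervalIntegral.integral_sub (i1.const_mul _) i2,
      ← intervalIntegral.integral_const_mul]
    refine intervalIntegral.integral_congr fun x hx => ?_
    rw [Set.uIcc_of_le hb] at hx
    have hx0 : 0 < x := hr0.trans_le hx.1
    have hxC : (x : ℂ) ≠ 0 := by exact_mod_cast hx0.ne'
    have hωC : (ω : ℂ) ≠ 0 := by exact_mod_cast hω.ne'
    have hxν : ((x ^ ν : ℝ) : ℂ) ≠ 0 := by exact_mod_cast (Real.rpow_pos_of_pos hx0 ν).ne'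
    have hd : (ω : ℂ) ^ 2 - (x : ℂ) ^ 2 ≠ 0 := by
      have : ω ^ 2 - x ^ 2 ≠ 0 := by nlinarith [hx.1]
      exact_mod_cast this
    have e1 : x ^ (2 * (k : ℝ) + ν + 2) = x ^ (2 * k + 2) * x ^ ν := by
      rw [← Real.rpow_natCast, ← Real.rpow_add hx0]; push_cast; ring_nf
    simp only [parityKernel]
    rw [e1, inv_pow, inv_pow]
    push_cast
    field_simp
    ring
  have heb : ∀ k b, r ≤ b → ‖e k b‖ ≤ ω⁻¹ * M * (ω ^ 2 * r⁻¹ ^ 2 + 1) * (r⁻¹ ^ 2) ^ k := by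
    intro k b hb
    have b1 := norm_integral_mul_inv_pow_le hω.le hr hb hcont (2 * k + 2) fun x hx _ => hM x hx
    have b2 := norm_integral_mul_inv_pow_le hω.le hr hb hcont (2 * k) fun x hx _ => hM x hx
    rw [heA k b hb, norm_mul, norm_inv, Complex.norm_real, Real.norm_of_nonneg hω.le]
    calc _ ≤ ω⁻¹ * (ω ^ 2 * (M * r⁻¹ ^ (2 * k + 2)) + M * r⁻¹ ^ (2 * k)) := by
          gcongr
          refine (norm_sub_le _ _).trans ?_
          rw [norm_mul, norm_pow, Complex.norm_real, Real.norm_of_nonneg hω.le]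
          gcongr
      _ = _ := by ring
  have hlim : ∀ k, ∃ E, Tendsto (e k) atTop (𝓝 E) := by
    intro k
    obtain ⟨E1, h1⟩ := exists_tendsto_integral_mul_inv_pow hω.le hr hcont (2 * k + 2) hL
    obtain ⟨E2, h2⟩ := exists_tendsto_integral_mul_inv_pow hω.le hr hcont (2 * k) hL
    refine ⟨_, (((h1.const_mul ((ω : ℂ) ^ 2)).sub h2).const_mul (ω : ℂ)⁻¹).congr' ?_⟩
    filter_upwards [eventually_ge_atTop r] with b hb
    exact (heA k b hb).symm
  choose E hE using hlim
  have hfp : ∀ (k : ℕ) (b : ℝ), r ≤ b → HasFinitePartTo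
      (fun x : ℝ => f (x : ℂ) / ((x ^ (2 * (k : ℝ) + ν + 2) : ℝ) : ℂ)) b (F k + e k b) :=
    fun k b hb => (hF k).1.extend hr0 hb (intervalIntegrable_div_rpow _ hr0 hb fun x h0 _ => hf x h0)
  set D := C + ω⁻¹ * M * (ω ^ 2 * r⁻¹ ^ 2 + 1) with hD
  have hbound : ∀ (k : ℕ) (b : ℝ), r ≤ b → ‖F k + e k b‖ ≤ D * (r⁻¹ ^ 2) ^ k := fun k b hb => by
    rw [hD, add_mul]
    exact (norm_add_le _ _).trans (add_le_add (hF k).2 (heb k b hb))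
  have hsummable := summable_const_mul_div_sq_pow (ω * D) hω hr
  have hterm : ∀ k, Tendsto (fun b => (ω : ℂ) ^ (2 * k + 1) * (F k + e k b)) atTop
      (𝓝 ((ω : ℂ) ^ (2 * k + 1) * (F k + E k))) := fun k =>
    ((hE k).const_add (F k)).const_mul _
  have hev : ∀ᶠ b in atTop, ∀ k, ‖(ω : ℂ) ^ (2 * k + 1) * (F k + e k b)‖
      ≤ ω * D * ((ω / r) ^ 2) ^ k := by
    filter_upwards [eventually_ge_atTop r] with b hb k
    exact norm_odd_pow_mul_le hω (hbound k b hb)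
  have htsum := tendsto_tsum_of_dominated_convergence hsummable hterm hev
  refine ⟨fun k => F k + E k, ∑' k, (ω : ℂ) ^ (2 * k + 1) * (F k + E k), fun k => ?_, ?_, ?_⟩
  · refine Or.inr ⟨rfl, fun b => F k + e k b, ?_, (hE k).const_add (F k)⟩
    filter_upwards [eventually_ge_atTop r] with b hb
    exact hfp k b hb
  · refine (Summable.of_norm_bounded hsummable fun k => ?_).hasSum
    exact le_of_tendsto (hterm k).norm (hev.mono fun b hb => hb k)
  · refine Or.inr ⟨rfl, _, ?_, htsum.neg.add_const _⟩
    filter_upwards [eventually_ge_atTop r] with b hb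
    obtain ⟨F', S', hF', hS', hP'⟩ := exists_hasSum_hasPVTo_parityKernel hν0 hν1 hω
      (hr.trans_le hb) hωρ (fun x h0 _ => hf x h0) hfρ
    -- Uniqueness of finite parts identifies the coefficients of the finite-`b` formula with those
    -- that are dominated.
    have hFF : F' = fun k => F k + e k b := funext fun k =>
      (hF' k).unique (hr0.trans_le hb) (hfp k b hb)
    rw [hFF] at hS'
    rw [hS'.tsum_eq]
    exact hP'

/-! ### Assembling the three cases -/

theorem HasValueTo.mono {Q R : ℝ → ℂ → Prop} {a : EReal} {I : ℂ} (ha : 0 < a)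
    (h : HasValueTo Q a I)
    (hQR : ∀ b : ℝ, 0 < b → (b : EReal) ≤ a → ∀ J, Q b J → R b J) : HasValueTo R a I := by
  rcases h with ⟨b, rfl, hb⟩ | ⟨rfl, P, hP, hI⟩
  · exact Or.inl ⟨b, rfl, hQR b (by exact_mod_cast ha) le_rfl I hb⟩
  · refine Or.inr ⟨rfl, P, ?_, hI⟩
    filter_upwards [hP, eventually_gt_atTop 0] with b hb hb0
    exact hQR b hb0 le_top _ hb

theorem exists_pos_analyticAt_of_lt_singularityDist {f : ℂ → ℂ} {ω : ℝ}
    (hωρ : ENNReal.ofReal ω < singularityDist f) :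
    ∃ ρ : ℝ, ω < ρ ∧ ∀ z : ℂ, ‖z‖ < ρ → AnalyticAt ℂ f z := by
  obtain ⟨ρ, h1, h2⟩ := ENNReal.lt_iff_exists_nnreal_btwn.1 hωρ
  refine ⟨ρ, ?_, fun z hz => ?_⟩
  · by_contra! h
    refine absurd h1 (not_lt.2 ?_)
    rw [← ENNReal.ofReal_coe_nnreal]
    exact ENNReal.ofReal_le_ofReal h
  · by_contra hn
    have h3 : singularityDist f ≤ edist 0 z := Metric.infEDist_le_edist_of_mem hn
    rw [edist_dist, dist_zero_left] at h3
    refine absurd (h2.trans_le h3) (not_lt.2 ?_)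
    rw [← ENNReal.ofReal_coe_nnreal]
    exact ENNReal.ofReal_le_ofReal hz.le

theorem exists_hasSum_hasPVUpTo {f : ℂ → ℂ} {a : EReal} {ν ω : ℝ}
    (hν0 : 0 < ν) (hν1 : ν < 1) (hf : ComplexAnalyticUpTo f a) (hω : 0 < ω)
    (hωa : (ω : EReal) < a) (hωρ : ENNReal.ofReal ω < singularityDist f)
    (htop : a = ⊤ →
      (∃ I : ℂ, HasPVUpTo (parityKernel f ν ω) ω ⊤ I) ∨
      IntegrableAtFilter (fun x : ℝ => f (x : ℂ) / ((x ^ (2 + ν) : ℝ) : ℂ)) atTop volume) :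
    ∃ (F : ℕ → ℂ) (S : ℂ), (∀ k : ℕ, HasFinitePartUpTo
      (fun x : ℝ => f (x : ℂ) / ((x ^ (2 * (k : ℝ) + ν + 2) : ℝ) : ℂ)) a (F k)) ∧
      HasSum (fun k : ℕ => (ω : ℂ) ^ (2 * k + 1) * F k) S ∧
      HasPVUpTo (parityKernel f ν ω) ω a
          (-S + ((Real.pi / (2 * ω ^ ν) : ℝ) : ℂ) *
            (f (-(ω : ℂ)) / ((Real.sin (Real.pi * ν) : ℝ) : ℂ)
              - f (ω : ℂ) * ((Real.cot (Real.pi * ν) : ℝ) : ℂ))) := by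
  obtain ⟨ρ, hρ, hfρ⟩ := exists_pos_analyticAt_of_lt_singularityDist hωρ
  induction a with
  | bot => exact absurd hωa not_lt_bot
  | top => exact exists_hasSum_hasPVUpTo_top hν0 hν1 hω hρ (fun x h0 => hf x h0 le_top) hfρ (htop rfl)
  | coe b =>
    obtain ⟨F, S, h1, h2, h3⟩ := exists_hasSum_hasPVTo_parityKernel hν0 hν1 hω
      (EReal.coe_lt_coe_iff.1 hωa) hρ (fun x h0 hb => hf x h0 (EReal.coe_le_coe_iff.2 hb)) hfρ
    exact ⟨F, S, fun k => Or.inl ⟨b, rfl, h1 k⟩, h2, Or.inl ⟨b, rfl, h3⟩⟩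

/-- Analyticity of `f` is an open condition, so `g = f/z^m` holds throughout a neighbourhood of `z ≠
0`. -/
theorem analyticAt_of_eq_pow_mul {f g : ℂ → ℂ} {m : ℕ} {z : ℂ} (hz : z ≠ 0)
    (hf : AnalyticAt ℂ f z) (h : ∀ z : ℂ, AnalyticAt ℂ f z → f z = z ^ m * g z) :
    AnalyticAt ℂ g z := by
  refine (hf.mul ((analyticAt_id.pow m).inv (pow_ne_zero m hz))).congr ?_
  filter_upwards [hf.eventually_analyticAt, isOpen_ne.mem_nhds hz] with w hw hw0
  have hw0 : w ≠ 0 := hw0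
  simp only [Pi.mul_apply, Pi.inv_apply, Pi.pow_apply, id_eq]
  rw [h w hw]
  field_simp

theorem div_rpow_eq_rpow_mul {m k : ℕ} {ν x : ℝ} {w : ℂ} (hx : 0 < x) :
    (x : ℂ) ^ m * w / ((x ^ (2 * (k : ℝ) + ν + 2) : ℝ) : ℂ)
      = ((x ^ ((m : ℝ) - 2 * (k : ℝ) - ν - 2) : ℝ) : ℂ) * w := by
  rw [show (m : ℝ) - 2 * (k : ℝ) - ν - 2 = m - (2 * (k : ℝ) + ν + 2) by ring, Real.rpow_sub hx,
    Real.rpow_natCast]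
  push_cast
  ring

theorem theorem5p3 (f : ℂ → ℂ) (a : EReal) (ν ω : ℝ)
    (hν0 : 0 < ν) (hν1 : ν < 1)
    (hf : ComplexAnalyticUpTo f a)
    (hω0 : 0 < ω) (hωa : (ω : EReal) < a)
    (hωρ : ENNReal.ofReal ω < singularityDist f)
    -- if the upper limit is infinite: the principal value exists, or `f(x) x^(-2-ν)` is
    -- integrable at infinity
    (htop : a = ⊤ →
      (∃ I : ℂ, HasPVUpTo (parityKernel f ν ω) ω ⊤ I) ∨
      IntegrableAtFilter (fun x : ℝ => f (x : ℂ) / ((x ^ (2 + ν) : ℝ) : ℂ)) atTop volume) :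
    -- the general case
    (f 0 ≠ 0 →
      ∃ (F : ℕ → ℂ) (S : ℂ),
        (∀ k : ℕ, HasFinitePartUpTo
          (fun x : ℝ => f (x : ℂ) / ((x ^ (2 * (k : ℝ) + ν + 2) : ℝ) : ℂ)) a (F k)) ∧
        HasSum (fun k : ℕ => (ω : ℂ) ^ (2 * k + 1) * F k) S ∧
        HasPVUpTo (parityKernel f ν ω) ω a
          (-S + ((Real.pi / (2 * ω ^ ν) : ℝ) : ℂ) *
            (f (-(ω : ℂ)) / ((Real.sin (Real.pi * ν) : ℝ) : ℂ)
              - f (ω : ℂ) * ((Real.cot (Real.pi * ν) : ℝ) : ℂ)))) ∧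
    -- even `f`
    (f 0 ≠ 0 →
      (∀ x : ℝ, ENNReal.ofReal |x| < singularityDist f → f (-(x : ℂ)) = f (x : ℂ)) →
      ∃ (F : ℕ → ℂ) (S : ℂ),
        (∀ k : ℕ, HasFinitePartUpTo
          (fun x : ℝ => f (x : ℂ) / ((x ^ (2 * (k : ℝ) + ν + 2) : ℝ) : ℂ)) a (F k)) ∧
        HasSum (fun k : ℕ => (ω : ℂ) ^ (2 * k + 1) * F k) S ∧
        HasPVUpTo (parityKernel f ν ω) ω a
          (-S + ((Real.pi / 2 : ℝ) : ℂ) * (f (ω : ℂ) / ((ω ^ ν : ℝ) : ℂ)) *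
            ((Real.tan (Real.pi * ν / 2) : ℝ) : ℂ))) ∧
    -- `f` with a zero of order `m` at the origin; the index `k` of the finite sum satisfies
    -- `0 ≤ k ≤ ⌊(m - 2) / 2⌋`, that is, `k < ⌊m / 2⌋`
    (∀ (m : ℕ) (g : ℂ → ℂ), 0 < m → AnalyticAt ℂ g 0 → g 0 ≠ 0 →
      (∀ z : ℂ, AnalyticAt ℂ f z → f z = z ^ m * g z) →
      ∃ (J F : ℕ → ℂ) (S : ℂ),
        (∀ k : ℕ, k < m / 2 → HasIntegralUpTo
          (fun x : ℝ => ((x ^ ((m : ℝ) - 2 * (k : ℝ) - ν - 2) : ℝ) : ℂ) * g (x : ℂ)) a (J k)) ∧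
        (∀ k : ℕ, HasFinitePartUpTo
          (fun x : ℝ => (x : ℂ) ^ m * g (x : ℂ) /
            ((x ^ (2 * (k : ℝ) + 2 * ((m / 2 : ℕ) : ℝ) + ν + 2) : ℝ) : ℂ)) a (F k)) ∧
        HasSum (fun k : ℕ => (ω : ℂ) ^ (2 * k + 2 * (m / 2) + 1) * F k) S ∧
        HasPVUpTo (parityKernel f ν ω) ω a
          (-(∑ k ∈ Finset.range (m / 2), (ω : ℂ) ^ (2 * k + 1) * J k) - S
            - ((Real.pi * ω ^ ((m : ℝ) - ν) / 2 : ℝ) : ℂ) *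
              (g (ω : ℂ) * ((Real.cot (Real.pi * ν) : ℝ) : ℂ)
                - (-1) ^ m * g (-(ω : ℂ)) / ((Real.sin (Real.pi * ν) : ℝ) : ℂ)))) := by

  obtain ⟨F, S, hF, hS, hPV⟩ := exists_hasSum_hasPVUpTo hν0 hν1 hf hω0 hωa hωρ htop
  obtain ⟨ρ, hρ, hfρ⟩ := exists_pos_analyticAt_of_lt_singularityDist hωρ
  have ha0 : 0 < a := lt_trans (by exact_mod_cast hω0) hωa
  refine ⟨fun _ => ⟨F, S, hF, hS, hPV⟩, fun _ heven => ⟨F, S, hF, hS, ?_⟩, ?_⟩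
  · have h1 : f (-(ω : ℂ)) = f ω := heven ω (by rwa [abs_of_pos hω0])
    have h2 := congrArg (fun x : ℝ => (x : ℂ)) (inv_sin_sub_cot hν0 hν1).1
    convert hPV using 2
    rw [h1]
    rw [← h2]
    push_cast
    ring
  · intro m g _ hg _ hfg
    have hfx : ∀ x : ℝ, 0 ≤ x → (x : EReal) ≤ a → f x = (x : ℂ) ^ m * g x := fun x h0 hxa =>
      hfg x (hf x h0 hxa)
    have hga : ∀ x : ℝ, 0 ≤ x → (x : EReal) ≤ a → AnalyticAt ℂ g x := fun x h0 hxa => by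
      rcases h0.eq_or_lt with rfl | h0'
      · simpa using hg
      · exact analyticAt_of_eq_pow_mul (by exact_mod_cast h0'.ne') (hf x h0 hxa) hfg
    have hle : ∀ {x b : ℝ}, x ≤ b → (b : EReal) ≤ a → (x : EReal) ≤ a := fun h1 h2 =>
      (EReal.coe_le_coe_iff.2 h1).trans h2
    -- The series of the general case is cut at `k = m/2`: its head supplies the ordinary integrals,
    -- its tail the shifted finite parts.
    refine ⟨F, fun k => F (k + m / 2), S - ∑ k ∈ Finset.range (m / 2), (ω : ℂ) ^ (2 * k + 1) * F k,
      fun k hk => ?_, fun k => ?_, ?_, ?_⟩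
    · refine HasValueTo.mono ha0 (hF k) fun b hb hba J hJ => ?_
      -- `k < m/2` gives `2k + 2 ≤ m`, so the exponent is at least `-ν`; the finite part is then an
      -- ordinary integral.
      have hp : -1 < (m : ℝ) - 2 * (k : ℝ) - ν - 2 := by
        have : 2 * k + 2 ≤ m := by omega
        have : 2 * (k : ℝ) + 2 ≤ m := by exact_mod_cast this
        linarith
      have hi := intervalIntegrable_rpow_mul hp hb fun x h0 hxb => hga x h0 (hle hxb hba)
      refine ⟨hi, (hasFinitePartTo_of_intervalIntegrable hb hi).unique hb
        (hJ.congr hb fun x h0 hxb => ?_)⟩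
      rw [hfx x h0.le (hle hxb hba), div_rpow_eq_rpow_mul h0]
    · refine HasValueTo.mono ha0 (hF (k + m / 2)) fun b hb hba J hJ =>
        hJ.congr hb fun x h0 hxb => ?_
      rw [hfx x h0.le (hle hxb hba), Nat.cast_add, mul_add]
    · refine ((hasSum_nat_add_iff' (m / 2)).2 hS).congr_fun fun k => ?_
      rw [show 2 * (k + m / 2) + 1 = 2 * k + 2 * (m / 2) + 1 by ring]
    · have hn : ‖(ω : ℂ)‖ < ρ := by rwa [Complex.norm_real, Real.norm_of_nonneg hω0.le]
      have f1 := hfg ω (hfρ _ hn)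
      have f2 := hfg (-ω) (hfρ _ (by rwa [norm_neg]))
      convert hPV using 1
      rw [f1, f2, Real.rpow_sub hω0, Real.rpow_natCast, neg_pow]
      push_cast
      ring
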